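/- Let $K$ be a field. **Colored quivers.** A colored quiver $\Gamma$ consists of sets $\Gamma_0$ (vertices), $\Gamma_1$ (arrows), $C$ (colors) and maps $s,t\colon\Gamma_1\to\Gamma_0$ (source, target) and $u\colon\Gamma_1\to C$ (color). A path $\mathbf r=r_1\cdots r_l$ of length $l\ge 1$ is a sequence of arrows with $t(r_i)=s(r_{i+1})$; it has $s(\mathbf r)=s(r_1)$, $t(\mathbf r)=t(r_l)$ and $u(\mathbf r)=u(r_1)\cdots u(r_l)$ in the free monoid $C^*$. For each vertex $v$ there is also a path of length $0$ with source and target $v$ and $u=1$. Let $K\langle\langle C\rangle\rangle=\prod_{\mathbf c\in C^*}K\mathbf c$ be the formal monoid algebra, and let $F_\Gamma$ be its $K$-subalgebra of all $f=\sum\lambda_{\mathbf c}\mathbf c$ such that for every vertex $v$ there are only finitely many paths $\mathbf r$ with $t(\mathbf r)=v$ and $\lambda_{u(\mathbf r)}\ne 0$. Let $M_\Gamma=\prod_{v\in\Gamma_0}Kx_v$ be the right $F_\Gamma$-module with action $$\Big(\sum_v\mu_vx_v\Big)\Big(\sum_{\mathbf c}\lambda_{\mathbf c}\mathbf c\Big)=\sum_{\mathbf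 r}\lambda_{u(\mathbf r)}\mu_{s(\mathbf r)}x_{t(\mathbf r)},$$ the sum being over all paths $\mathbf r$ in $\Gamma$. Let $\mathcal G_\Gamma$ be the smallest full subcategory of $\mathrm{Mod}\,F_\Gamma$ (right modules) that contains $M_\Gamma$ and is closed under subobjects, quotients and direct sums. **The quiver $\widetilde\Gamma$.** It has vertices $\mathbb N\times\Gamma_0$ (with $0\in\mathbb N$), colors $C\amalg\{c_{v,w}\mid v,w\in\Gamma_0\}$, arrows $(i,r)\colon(i,s(r))\to(i,t(r))$ of color $u(r)$ for $i\in\mathbb N$, $r\in\Gamma_1$, and arrows $r^i_{v,w}\colon(i,v)\to(i+1,w)$ of color $c_{v,w}$ for $i\in\mathbb N$, $v,w\in\Gamma_0$. Restricting coefficients from $(C\amalg\{c_{v,w}\})^*$ to $C^*$ gives a surjective ring homomorphism $F_{\widetilde\Gamma}\to F_\Gamma$; restriction of scalars along it embeds $\mathcal G_\Gamma$ into $\mathcal G_{\widetilde\Gamma}$. **Atoms.** In an abelian category $\mathcal G$, a nonzero object $H$ is *compressible* if each nonzero subobject of $H$ contains a subobject isomorphic to $H$. A nonzero object $H$ is *monoform*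 if for every nonzero subobject $L$ of $H$ the only subobject of $H$ isomorphic to a subobject of $H/L$ is $0$. Monoform objects $H_1,H_2$ are atom-equivalent if $H_1$ has a nonzero subobject isomorphic to a subobject of $H_2$. $\mathrm{ASpec}\,\mathcal G$ is the class of monoform objects modulo atom equivalence, $\overline H$ is the class (atom) of $H$, and $\mathrm{ASupp}\,M=\{\overline H\mid H\text{ is a monoform subquotient of }M\}$. When $\mathcal G$ is a Grothendieck category, the sets $\mathrm{ASupp}\,M$ ($M\in\mathcal G$) are the open sets of a topology on $\mathrm{ASpec}\,\mathcal G$, and $\alpha\le\beta$ means that $\alpha$ lies in the closure of $\{\beta\}$. **Proposition.** Let $\Gamma$ be a colored quiver with $\Gamma_0\ne\emptyset$ such that * (a) $M_\Gamma$ is a noetherian object of $\mathcal G_\Gamma$; * (b) every nonzero object of $\mathcal G_\Gamma$ has a compressible subobject. Then: 1. $M_{\widetilde\Gamma}$ is a compressible noetherian object of $\mathcal G_{\widetilde\Gamma}$, and $\mathcal G_{\widetilde\Gamma}$ is a locally noetherian Grothendieck category (a Grothendieck category with a small generating set of noetherian objects). 2. Every nonzero object of $\mathcal G_{\widetilde\Gamma}$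 has a compressible subobject. 3. $M_{\widetilde\Gamma}$ is monoform, and the embedding $\mathcal G_\Gamma\hookrightarrow\mathcal G_{\widetilde\Gamma}$ sends monoform objects to monoform objects and induces, by $\overline H\mapsto\overline H$, an order embedding $\mathrm{ASpec}\,\mathcal G_\Gamma\hookrightarrow\mathrm{ASpec}\,\mathcal G_{\widetilde\Gamma}$. Identifying $\mathrm{ASpec}\,\mathcal G_\Gamma$ with its image, one has $$\mathrm{ASpec}\,\mathcal G_{\widetilde\Gamma}=\mathrm{ASpec}\,\mathcal G_\Gamma\cup\{\overline{M_{\widetilde\Gamma}}\},$$ and $\overline{M_{\widetilde\Gamma}}$ is strictly smaller than every element of $\mathrm{ASpec}\,\mathcal G_\Gamma$. -/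

import Mathlib

open CategoryTheory CategoryTheory.Limits

universe w v u

/-! ### Compressible and monoform objects, the atom spectrum -/

section AtomSpectrum

variable {C : Type u} [Category.{v} C]

/-- `X` is a subquotient of `M`: a quotient object of a subobject of `M`. -/
def IsSubquotient (X M : C) : Prop :=
  ∃ (L : Subobject M) (p : (L : C) ⟶ X), Epi p

theorem isSubquotient_iff {X M : C} : IsSubquotient X M ↔
    ∃ (L : C) (i : L ⟶ M) (p : L ⟶ X), Mono i ∧ Epi p := by
  constructor
  · rintro ⟨L, p, hp⟩
    exact ⟨L, L.arrow, p, inferInstance, hp⟩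
  · rintro ⟨L, i, p, _, _⟩
    exact ⟨Subobject.mk i, (Subobject.underlyingIso i).hom ≫ p, inferInstance⟩

variable [Abelian C]

/-- A compressible object: it is nonzero and each nonzero subobject contains a subobject
isomorphic to the whole object. -/
def IsCompressible (H : C) : Prop :=
  ¬ IsZero H ∧ ∀ L : Subobject H, L ≠ ⊥ →
    ∃ N : Subobject H, N ≤ L ∧ Nonempty ((N : C) ≅ H)

variable (C) in
/-- Every nonzero object of `C` has a compressible subobject. -/
def HasEnoughCompressibles : Prop :=
  ∀ X : C, ¬ IsZero X → ∃ L : Subobject X, IsCompressible (L : C)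

/-- A monoform object: it is nonzero and, for every nonzero subobject `L` of `H`, the only
subobject of `H` isomorphic to a subobject of `H / L` is the zero subobject. -/
def IsMonoform (H : C) : Prop :=
  ¬ IsZero H ∧ ∀ L : Subobject H, L ≠ ⊥ → ∀ N : Subobject H,
    (∃ N' : Subobject (cokernel L.arrow), Nonempty ((N : C) ≅ (N' : C))) → N = ⊥

/-- `H₁` has a nonzero subobject that is isomorphic to a subobject of `H₂`. -/
def AtomEquivalent (H₁ H₂ : C) : Prop :=
  ∃ L : Subobject H₁, L ≠ ⊥ ∧ ∃ N : Subobject H₂, Nonempty ((L : C) ≅ (N : C))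

theorem subobject_ne_bot_iff {H : C} (L : Subobject H) : L ≠ ⊥ ↔ ¬ IsZero (L : C) := by
  rw [not_iff_not]
  constructor
  · rintro rfl
    exact (isZero_zero C).of_iso Subobject.botCoeIsoZero
  · intro h
    rw [← Subobject.mk_arrow L, Subobject.mk_eq_bot_iff_zero]
    exact h.eq_of_src _ _

theorem atomEquivalent_iff {H₁ H₂ : C} : AtomEquivalent H₁ H₂ ↔
    ∃ (X : C) (i : X ⟶ H₁) (j : X ⟶ H₂), Mono i ∧ Mono j ∧ ¬ IsZero X := by
  constructor
  · rintro ⟨L, hL, N, ⟨e⟩⟩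
    exact ⟨L, L.arrow, e.hom ≫ N.arrow, inferInstance, inferInstance,
      (subobject_ne_bot_iff L).1 hL⟩
  · rintro ⟨X, i, j, _, _, hX⟩
    refine ⟨Subobject.mk i, ?_, Subobject.mk j,
      ⟨Subobject.underlyingIso i ≪≫ (Subobject.underlyingIso j).symm⟩⟩
    rw [subobject_ne_bot_iff]
    exact fun h => hX (h.of_iso (Subobject.underlyingIso i).symm)

theorem IsMonoform.mono_of_epi {H : C} (hH : IsMonoform H) {Q X : C} (q : H ⟶ Q) [Epi q]
    (i : X ⟶ H) [Mono i] (j : X ⟶ Q) [Mono j] (hX : ¬ IsZero X) : Mono q := by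
  by_contra hq
  have hL : Subobject.mk (kernel.ι q) ≠ ⊥ := by
    intro h
    rw [Subobject.mk_eq_bot_iff_zero] at h
    exact hq (Preadditive.mono_of_kernel_zero h)
  let L := Subobject.mk (kernel.ι q)
  have hLq : L.arrow ≫ q = 0 := by
    rw [← Subobject.underlyingIso_hom_comp_eq_mk (kernel.ι q)]
    simp
  let d : Q ⟶ cokernel L.arrow := Abelian.epiDesc q (cokernel.π L.arrow) (by
    rw [← Subobject.underlyingIso_arrow (kernel.ι q), Category.assoc, cokernel.condition,
      comp_zero])
  have hd : q ≫ d = cokernel.π L.arrow := Abelian.comp_epiDesc _ _ _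
  have hd' : d ≫ cokernel.desc L.arrow q hLq = 𝟙 Q := by
    rw [← cancel_epi q, ← Category.assoc, hd]
    simp
  have : Mono d := mono_of_mono_fac hd'
  have := hH.2 L hL (Subobject.mk i) ⟨Subobject.mk (j ≫ d),
    ⟨Subobject.underlyingIso i ≪≫ (Subobject.underlyingIso (j ≫ d)).symm⟩⟩
  rw [Subobject.mk_eq_bot_iff_zero] at this
  exact hX (IsZero.of_mono_eq_zero i this)

theorem IsMonoform.pullback_ne_zero {H X Y : C} (hH : IsMonoform H) (i : X ⟶ H) [Mono i]
    (j : Y ⟶ H) [Mono j] (hX : ¬ IsZero X) (hY : ¬ IsZero Y) : ¬ IsZero (pullback i j) := by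
  intro h0
  have : Mono (j ≫ cokernel.π i) := by
    refine Preadditive.mono_of_cancel_zero _ fun {T} g hg => ?_
    rw [← Category.assoc] at hg
    have h : Abelian.monoLift i (g ≫ j) hg ≫ i = g ≫ j := Abelian.monoLift_comp _ _ _
    rw [← pullback.lift_snd (f := i) (g := j) _ _ h, h0.eq_of_tgt (pullback.lift _ _ h) 0,
      zero_comp]
  have := hH.mono_of_epi (cokernel.π i) j (j ≫ cokernel.π i) hY
  refine hX (IsZero.of_mono_eq_zero i ?_)
  rw [← cancel_mono (cokernel.π i), cokernel.condition, zero_comp]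

theorem AtomEquivalent.symm {H₁ H₂ : C} (h : AtomEquivalent H₁ H₂) : AtomEquivalent H₂ H₁ := by
  rw [atomEquivalent_iff] at h ⊢
  obtain ⟨X, i, j, hi, hj, hX⟩ := h
  exact ⟨X, j, i, hj, hi, hX⟩

theorem AtomEquivalent.trans {H₁ H₂ H₃ : C} (h₂ : IsMonoform H₂) (h : AtomEquivalent H₁ H₂)
    (h' : AtomEquivalent H₂ H₃) : AtomEquivalent H₁ H₃ := by
  rw [atomEquivalent_iff] at h h' ⊢
  obtain ⟨X, i, j, _, _, hX⟩ := h
  obtain ⟨Y, k, l, _, _, hY⟩ := h'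
  exact ⟨pullback j k, pullback.fst j k ≫ i, pullback.snd j k ≫ l, inferInstance, inferInstance,
    h₂.pullback_ne_zero j k hX hY⟩

theorem IsMonoform.atomEquivalent_self {H : C} (h : IsMonoform H) : AtomEquivalent H H :=
  atomEquivalent_iff.2 ⟨H, 𝟙 H, 𝟙 H, inferInstance, inferInstance, h.1⟩

variable (C) in
/-- Atom equivalence on the monoform objects of `C`. -/
def atomSetoid : Setoid {H : C // IsMonoform H} where
  r H₁ H₂ := AtomEquivalent H₁.1 H₂.1
  iseqv :=
    { refl := fun H => H.2.atomEquivalent_self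
      symm := AtomEquivalent.symm
      trans := fun {_ H₂ _} h h' => h.trans H₂.2 h' }

variable (C) in
/-- The atom spectrum: monoform objects modulo atom equivalence. -/
def ASpec : Type u := Quotient (atomSetoid C)

/-- The atom `H̄` of a monoform object `H`. -/
def atom (H : C) (h : IsMonoform H) : ASpec C := Quotient.mk (atomSetoid C) ⟨H, h⟩

theorem atom_eq_iff {H₁ H₂ : C} {h₁ : IsMonoform H₁} {h₂ : IsMonoform H₂} :
    atom H₁ h₁ = atom H₂ h₂ ↔ AtomEquivalent H₁ H₂ :=
  Quotient.eq (r := atomSetoid C)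

theorem atom_surjective (α : ASpec C) : ∃ (H : C) (h : IsMonoform H), atom H h = α := by
  induction α using Quotient.inductionOn with
  | h H => exact ⟨H.1, H.2, rfl⟩

/-- The atom support of `M`: the atoms of all monoform subquotients of `M`. -/
def ASupp (M : C) : Set (ASpec C) :=
  {α | ∃ (H : C) (h : IsMonoform H), IsSubquotient H M ∧ atom H h = α}

/-- The open subsets of the atom spectrum in the localizing topology: the atom supports. -/
def IsLocalizingOpen (Φ : Set (ASpec C)) : Prop := ∃ M : C, Φ = ASupp M

/-- The closure of a set of atoms in the localizing topology: the atoms all of whose open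
neighbourhoods meet the set. -/
def localizingClosure (S : Set (ASpec C)) : Set (ASpec C) :=
  {α | ∀ Φ : Set (ASpec C), IsLocalizingOpen Φ → α ∈ Φ → (Φ ∩ S).Nonempty}

theorem mem_localizingClosure_singleton {α β : ASpec C} :
    α ∈ localizingClosure {β} ↔ ∀ M : C, α ∈ ASupp M → β ∈ ASupp M := by
  constructor
  · intro h M hM
    obtain ⟨γ, h₁, rfl⟩ := h _ ⟨M, rfl⟩ hM
    exact h₁
  · rintro h _ ⟨M, rfl⟩ hM
    exact ⟨β, h M hM, rfl⟩

theorem IsSubquotient.exists_epi_mono {X M : C} (h : IsSubquotient X M) :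
    ∃ (Q : C) (q : M ⟶ Q) (j : X ⟶ Q), Epi q ∧ Mono j := by
  obtain ⟨L, i, p, _, _⟩ := isSubquotient_iff.1 h
  exact ⟨pushout i p, pushout.inl i p, pushout.inr i p, inferInstance, inferInstance⟩

theorem atomEquivalent_of_specialize {H₁ H₂ : C} (h₁ : IsMonoform H₁) (h₂ : IsMonoform H₂)
    (h : ∀ M : C, atom H₁ h₁ ∈ ASupp M ↔ atom H₂ h₂ ∈ ASupp M) : AtomEquivalent H₁ H₂ := by
  have hs : atom H₁ h₁ ∈ ASupp H₁ :=
    ⟨H₁, h₁, isSubquotient_iff.2 ⟨H₁, 𝟙 _, 𝟙 _, inferInstance, inferInstance⟩, rfl⟩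
  obtain ⟨H, hH, hsub, hat⟩ := (h _).1 hs
  obtain ⟨Q, q, j, _, _⟩ := hsub.exists_epi_mono
  have hQ : atom H₂ h₂ ∈ ASupp Q :=
    ⟨H, hH, isSubquotient_iff.2 ⟨H, j, 𝟙 _, inferInstance, inferInstance⟩, hat⟩
  obtain ⟨H', hH', hsub', hat'⟩ := (h _).2 hQ
  obtain ⟨Q', q', j', _, _⟩ := hsub'.exists_epi_mono
  obtain ⟨X, a, b, _, _, hX⟩ := atomEquivalent_iff.1 (atom_eq_iff.1 hat')
  have hm : Mono (q ≫ q') := h₁.mono_of_epi (q ≫ q') b (a ≫ j') hX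
  have : Mono q := mono_of_mono q q'
  have : IsIso q := isIso_of_mono_of_epi q
  refine AtomEquivalent.trans hH ?_ (atom_eq_iff.1 hat)
  exact atomEquivalent_iff.2 ⟨H, j ≫ inv q, 𝟙 H, inferInstance, inferInstance, hH.1⟩

/-- The specialization order on the atom spectrum. -/
instance : PartialOrder (ASpec C) where
  le α β := α ∈ localizingClosure {β}
  le_refl α := mem_localizingClosure_singleton.2 fun _ h => h
  le_trans α β γ h h' := mem_localizingClosure_singleton.2 fun M hM =>
    mem_localizingClosure_singleton.1 h' M (mem_localizingClosure_singleton.1 h M hM)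
  le_antisymm α β h h' := by
    obtain ⟨H₁, h₁, rfl⟩ := atom_surjective α
    obtain ⟨H₂, h₂, rfl⟩ := atom_surjective β
    exact atom_eq_iff.2 (atomEquivalent_of_specialize h₁ h₂ fun M =>
      ⟨mem_localizingClosure_singleton.1 h M, mem_localizingClosure_singleton.1 h' M⟩)

variable (C) in
/-- `C` is a locally noetherian Grothendieck category: a Grothendieck category with a small
generating family of noetherian objects. -/
def IsLocallyNoetherianGrothendieck : Prop :=
  IsGrothendieckAbelian.{w} C ∧ ∃ (ι : Type w) (G : ι → C),
    (∀ i, IsNoetherianObject (G i)) ∧ (ObjectProperty.ofObj G).IsSeparating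

end AtomSpectrum

/-! ### Weakly closed subcategories -/

section WeaklyClosed

variable {C : Type u} [Category.{v} C]

/-- A property of objects defining a weakly closed full subcategory: closed under subobjects,
quotients and (small) direct sums. -/
class IsWeaklyClosed (P : ObjectProperty C) : Prop extends
    P.IsClosedUnderSubobjects, P.IsClosedUnderQuotients where
  isClosedUnderCoproducts : ∀ J : Type w, P.IsClosedUnderColimitsOfShape (Discrete J)

/-- The smallest weakly closed subcategory containing `M`. -/
def weaklyClosedHull (M : C) : ObjectProperty C :=
  fun X => ∀ P : ObjectProperty C, IsWeaklyClosed.{w} P → P M → P X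

theorem weaklyClosedHull_self (M : C) : weaklyClosedHull.{w} M M := fun _ _ h => h

instance (M : C) : IsWeaklyClosed.{w} (weaklyClosedHull.{w} M) where
  prop_of_mono f _ h P hP hM := P.prop_of_mono f (h P hP hM)
  prop_of_epi f _ h P hP hM := P.prop_of_epi f (h P hP hM)
  isClosedUnderCoproducts J :=
    { colimitsOfShape_le := by
        rintro X ⟨c⟩ P hP hM
        have := hP.isClosedUnderCoproducts J
        exact P.prop_of_isColimit c.isColimit fun j => c.prop_diag_obj j P hP hM }

section Abelian

variable [Abelian C] (M : C)

open ZeroObject in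
instance : (weaklyClosedHull.{w} M).ContainsZero where
  exists_zero := ⟨0, isZero_zero C,
    (weaklyClosedHull.{w} M).prop_of_epi (0 : M ⟶ 0) (weaklyClosedHull_self M)⟩

instance : (weaklyClosedHull.{w} M).IsClosedUnderFiniteProducts := by
  have : (weaklyClosedHull.{w} M).IsClosedUnderColimitsOfShape (Discrete WalkingPair) := by
    have := IsWeaklyClosed.isClosedUnderCoproducts (P := weaklyClosedHull.{w} M)
      (ULift.{w} WalkingPair)
    exact .of_equivalence (Discrete.equivalence Equiv.ulift)
  have : (weaklyClosedHull.{w} M).IsClosedUnderBinaryProducts :=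
    { limitsOfShape_le := by
        rintro X ⟨c⟩
        have := HasFiniteBiproducts.of_hasFiniteProducts (C := C)
        let f : WalkingPair → C := fun j => c.diag.obj ⟨j⟩
        have hc : weaklyClosedHull.{w} M (∐ f) :=
          (weaklyClosedHull.{w} M).prop_colimit (Discrete.functor f) fun j => c.prop_diag_obj j
        exact (weaklyClosedHull.{w} M).prop_of_iso ((biproduct.isoCoproduct f).symm ≪≫
          biproduct.isoProduct f ≪≫ (IsLimit.conePointsIsoOfNatIso c.isLimit
            (limit.isLimit (Discrete.functor f)) Discrete.natIsoFunctor).symm) hc }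
  exact ObjectProperty.IsClosedUnderFiniteProducts.mk'

end Abelian

end WeaklyClosed

/-! ### Formal monoid algebras -/

section FormalMonoidAlgebra

/-- The formal monoid algebra `K⟨⟨C⟩⟩`: all formal sums `∑ λ_c c` over the free monoid on `C`,
represented by their coefficient functions. -/
def FormalMonoidAlgebra (K C : Type u) : Type u := FreeMonoid C → K

namespace FormalMonoidAlgebra

variable {K C : Type u}

theorem finite_splits (c : FreeMonoid C) :
    {p : FreeMonoid C × FreeMonoid C | p.1 * p.2 = c}.Finite := by
  refine ((Finset.range (c.length + 1)).finite_toSet.image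
    fun i => ((FreeMonoid.ofList (c.toList.take i), FreeMonoid.ofList (c.toList.drop i)) :
      FreeMonoid C × FreeMonoid C)).subset ?_
  rintro ⟨a, b⟩ rfl
  refine ⟨a.length, ?_, ?_⟩
  · simp [FreeMonoid.length_mul]
  · simp [FreeMonoid.toList_mul, FreeMonoid.length]

/-- The finite set of pairs `(c₁, c₂)` with `c₁ c₂ = c`. -/
noncomputable def splits (c : FreeMonoid C) : Finset (FreeMonoid C × FreeMonoid C) :=
  (finite_splits c).toFinset

@[simp]
theorem mem_splits {c : FreeMonoid C} {p : FreeMonoid C × FreeMonoid C} :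
    p ∈ splits c ↔ p.1 * p.2 = c := by
  simp [splits]

@[ext]
theorem ext {f g : FormalMonoidAlgebra K C} (h : ∀ c, f c = g c) : f = g := funext h

variable [Field K]

instance : AddCommGroup (FormalMonoidAlgebra K C) :=
  inferInstanceAs (AddCommGroup (FreeMonoid C → K))

instance : Module K (FormalMonoidAlgebra K C) :=
  inferInstanceAs (Module K (FreeMonoid C → K))

noncomputable instance : Mul (FormalMonoidAlgebra K C) where
  mul f g := fun c => ∑ p ∈ splits c, f p.1 * g p.2

open Classical in
noncomputable instance : One (FormalMonoidAlgebra K C) where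
  one := fun c => if c = 1 then 1 else 0

theorem mul_apply (f g : FormalMonoidAlgebra K C) (c : FreeMonoid C) :
    (f * g) c = ∑ p ∈ splits c, f p.1 * g p.2 := rfl

open Classical in
theorem one_apply (c : FreeMonoid C) :
    (1 : FormalMonoidAlgebra K C) c = if c = 1 then 1 else 0 := by
  rfl

@[simp]
theorem add_apply (f g : FormalMonoidAlgebra K C) (c : FreeMonoid C) : (f + g) c = f c + g c := rfl

@[simp]
theorem zero_apply (c : FreeMonoid C) : (0 : FormalMonoidAlgebra K C) c = 0 := rfl

@[simp]
theorem smul_apply (a : K) (f : FormalMonoidAlgebra K C) (c : FreeMonoid C) :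
    (a • f) c = a * f c := rfl

protected theorem one_mul (f : FormalMonoidAlgebra K C) : 1 * f = f := by
  ext c
  rw [mul_apply, Finset.sum_eq_single (1, c)]
  · simp [one_apply]
  · rintro ⟨a, b⟩ h hne
    have : a ≠ 1 := by
      rintro rfl
      simp_all
    simp [one_apply, this]
  · simp

protected theorem mul_one (f : FormalMonoidAlgebra K C) : f * 1 = f := by
  ext c
  rw [mul_apply, Finset.sum_eq_single (c, 1)]
  · simp [one_apply]
  · rintro ⟨a, b⟩ h hne
    have : b ≠ 1 := by
      rintro rfl
      simp_all
    simp [one_apply, this]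
  · simp

protected theorem mul_assoc (f g h : FormalMonoidAlgebra K C) : f * g * h = f * (g * h) := by
  ext c
  simp only [mul_apply, Finset.sum_mul, Finset.mul_sum, Finset.sum_sigma']
  refine Finset.sum_nbij' (fun x => ⟨(x.2.1, x.2.2 * x.1.2), (x.2.2, x.1.2)⟩)
    (fun x => ⟨(x.1.1 * x.2.1, x.2.2), (x.1.1, x.2.1)⟩) ?_ ?_ ?_ ?_ ?_ <;>
  simp only [Finset.mem_sigma, mem_splits] <;> rintro ⟨⟨a, b⟩, ⟨d, e⟩⟩ ⟨h₁, h₂⟩ <;>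
  simp_all [mul_assoc]
  all_goals simp_all [← mul_assoc]

noncomputable instance : Ring (FormalMonoidAlgebra K C) where
  __ := (inferInstance : AddCommGroup (FormalMonoidAlgebra K C))
  left_distrib f g h := by ext c; simp [mul_apply, mul_add, Finset.sum_add_distrib]
  right_distrib f g h := by ext c; simp [mul_apply, add_mul, Finset.sum_add_distrib]
  zero_mul f := by ext c; simp [mul_apply]
  mul_zero f := by ext c; simp [mul_apply]
  mul_assoc := FormalMonoidAlgebra.mul_assoc
  one_mul := FormalMonoidAlgebra.one_mul
  mul_one := FormalMonoidAlgebra.mul_one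

noncomputable instance : Algebra K (FormalMonoidAlgebra K C) :=
  Algebra.ofModule
    (fun r f g => by ext c; simp [mul_apply, Finset.mul_sum, mul_assoc])
    (fun r f g => by ext c; simp [mul_apply, Finset.mul_sum, mul_left_comm])

/-- The support of a formal sum. -/
def supp (f : FormalMonoidAlgebra K C) : Set (FreeMonoid C) := {c | f c ≠ 0}

end FormalMonoidAlgebra

end FormalMonoidAlgebra

/-! ### Colored quivers -/

/-- A colored quiver. -/
structure ColoredQuiver where
  /-- The set of vertices. -/
  Vertex : Type u
  /-- The set of arrows. -/
  Arrow : Type u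
  /-- The set of colors. -/
  Color : Type u
  /-- The source of an arrow. -/
  src : Arrow → Vertex
  /-- The target of an arrow. -/
  tgt : Arrow → Vertex
  /-- The color of an arrow. -/
  col : Arrow → Color

namespace ColoredQuiver

open Quiver FormalMonoidAlgebra

variable {K : Type u} [Field K] (Γ : ColoredQuiver.{u})

/-- The underlying quiver: the arrows `v ⟶ w` are the arrows with source `v` and target `w`. -/
instance : Quiver.{u} Γ.Vertex where
  Hom v w := {r : Γ.Arrow // Γ.src r = v ∧ Γ.tgt r = w}

variable {Γ}

/-- The sequence of colors of a path. -/
def pathColor {v : Γ.Vertex} : ∀ {w : Γ.Vertex}, Path v w → FreeMonoid Γ.Color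
  | _, Path.nil => 1
  | _, Path.cons p r => pathColor p * FreeMonoid.of (Γ.col r.1)

variable (Γ) in
/-- The set `P_v(B)` of all paths with target `v` whose sequence of colors lies in `B`. A path with
target `v` is given together with its source. -/
def pathsTo (v : Γ.Vertex) (B : Set (FreeMonoid Γ.Color)) : Set (Σ w : Γ.Vertex, Path w v) :=
  {r | pathColor r.2 ∈ B}

/-- Admissible elements of the formal monoid algebra. -/
def IsAdmissible (f : FormalMonoidAlgebra K Γ.Color) : Prop :=
  ∀ v : Γ.Vertex, (Γ.pathsTo v f.supp).Finite

@[simp]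
theorem pathColor_nil (v : Γ.Vertex) : pathColor (Path.nil : Path v v) = 1 := rfl

@[simp]
theorem pathColor_cons {v w x : Γ.Vertex} (p : Path v w) (r : w ⟶ x) :
    pathColor (p.cons r) = pathColor p * FreeMonoid.of (Γ.col r.1) := rfl

theorem pathColor_comp {v w x : Γ.Vertex} (p : Path v w) (q : Path w x) :
    pathColor (p.comp q) = pathColor p * pathColor q := by
  induction q with
  | nil => simp
  | cons q r ih => simp [ih, mul_assoc]

theorem length_pathColor {v w : Γ.Vertex} (p : Path v w) :
    (pathColor p).length = p.length := by
  induction p with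
  | nil => rfl
  | cons q r ih => simp [FreeMonoid.length_mul, ih]

/-- Each factorization of the sequence of colors of a path comes from a factorization of the
path. -/
theorem exists_comp_of_pathColor {v w : Γ.Vertex} (p : Path v w) (a b : FreeMonoid Γ.Color)
    (h : pathColor p = a * b) : ∃ (x : Γ.Vertex) (q : Path v x) (r : Path x w),
      p = q.comp r ∧ pathColor q = a ∧ pathColor r = b := by
  obtain ⟨x, q, r, rfl, hl⟩ := p.exists_eq_comp_of_le_length (n := a.length) (by
    rw [← length_pathColor, h, FreeMonoid.length_mul]; omega)
  rw [pathColor_comp] at h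
  have h' : (pathColor q).toList ++ (pathColor r).toList = a.toList ++ b.toList := h
  obtain ⟨h₁, h₂⟩ := List.append_inj h' ((length_pathColor q).trans hl)
  exact ⟨x, q, r, rfl, h₁, h₂⟩

theorem comp_unique {v w x x' : Γ.Vertex} {q : Path v x} {r : Path x w} {q' : Path v x'}
    {r' : Path x' w} (h : q.comp r = q'.comp r') (hl : r.length = r'.length) :
    (⟨x, q, r⟩ : Σ x, Path v x × Path x w) = ⟨x', q', r'⟩ := by
  induction r with
  | nil =>
    cases r' with
    | nil => simp_all
    | cons r' e' => simp at hl
  | cons r e ih =>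
    cases r' with
    | nil => simp at hl
    | cons r' e' =>
      simp only [Path.comp_cons, Path.cons.injEq] at h
      obtain ⟨rfl, h₁, h₂⟩ := h
      have := ih (eq_of_heq h₁) (by simpa using hl)
      cases this
      cases h₂
      rfl


variable (K Γ) in
/-- The `K`-algebra `F_Γ` of admissible elements of the formal monoid algebra. -/
noncomputable def admissibleAlgebra : Subalgebra K (FormalMonoidAlgebra K Γ.Color) where
  carrier := {f | IsAdmissible f}
  mul_mem' {f g} hf hg := by
    intro v
    refine (((hg v).biUnion fun r _ => (hf r.1).image
      fun q => (⟨q.1, q.2.comp r.2⟩ : Σ w, Path w v))).subset ?_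
    rintro ⟨w, p⟩ hp
    obtain ⟨⟨a, b⟩, hab, hne⟩ := Finset.exists_ne_zero_of_sum_ne_zero
      (show ∑ x ∈ splits (pathColor p), f x.1 * g x.2 ≠ 0 from hp)
    obtain ⟨x, q, r, rfl, rfl, rfl⟩ := exists_comp_of_pathColor p a b (mem_splits.1 hab).symm
    rw [Set.mem_iUnion₂]
    exact ⟨⟨x, r⟩, right_ne_zero_of_mul hne, ⟨w, q⟩, left_ne_zero_of_mul hne, rfl⟩
  add_mem' {f g} hf hg v := by
    refine ((hf v).union (hg v)).subset ?_
    rintro p hp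
    by_contra h
    simp_all [pathsTo, supp]
  algebraMap_mem' r := by
    intro v
    refine (Set.finite_singleton (⟨v, Path.nil⟩ : Σ w, Path w v)).subset ?_
    rintro ⟨w, p⟩ hp
    have h1 : pathColor p = 1 := by
      by_contra h
      refine hp ?_
      rw [Algebra.algebraMap_eq_smul_one, FormalMonoidAlgebra.smul_apply, one_apply, if_neg h,
        mul_zero]
    have h2 : p.length = 0 := by rw [← length_pathColor, h1]; rfl
    obtain rfl := p.eq_of_length_zero h2
    obtain rfl := p.eq_nil_of_length_zero h2
    rfl

theorem mem_admissibleAlgebra {f : FormalMonoidAlgebra K Γ.Color} :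
    f ∈ admissibleAlgebra K Γ ↔ IsAdmissible f := Iff.rfl

/-- The underlying `K`-vector space of `M_Γ`: the product of the lines `K x_v` over all vertices,
an element `∑ μ_v x_v` being represented by its family of coefficients. -/
def FormalModule (K : Type u) (Γ : ColoredQuiver.{u}) : Type u := Γ.Vertex → K

@[ext]
theorem FormalModule.ext {K : Type u} {Γ : ColoredQuiver.{u}} {y z : FormalModule K Γ}
    (h : ∀ v, y v = z v) : y = z := funext h

namespace FormalModule

instance : AddCommGroup (FormalModule K Γ) := inferInstanceAs (AddCommGroup (Γ.Vertex → K))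

@[simp]
theorem add_apply (y z : FormalModule K Γ) (v : Γ.Vertex) : (y + z) v = y v + z v := rfl

@[simp]
theorem zero_apply (v : Γ.Vertex) : (0 : FormalModule K Γ) v = 0 := rfl

end FormalModule

/-- The right action of admissible elements: `y f = ∑ λ_{u(r)} μ_{s(r)} x_{t(r)}`, the sum over all
paths `r`. The coefficient at `v` is the (finite) sum over the paths with target `v`. -/
noncomputable def act (y : FormalModule K Γ) (f : FormalMonoidAlgebra K Γ.Color) :
    FormalModule K Γ :=
  fun v => ∑ᶠ r : Σ w : Γ.Vertex, Path w v, f (pathColor r.2) * y r.1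

theorem act_apply (y : FormalModule K Γ) (f : FormalMonoidAlgebra K Γ.Color) (v : Γ.Vertex) :
    act y f v = ∑ᶠ r : Σ w : Γ.Vertex, Path w v, f (pathColor r.2) * y r.1 := rfl

theorem act_support_finite (y : FormalModule K Γ) {f : FormalMonoidAlgebra K Γ.Color}
    (hf : IsAdmissible f) (v : Γ.Vertex) :
    (Function.support fun r : Σ w : Γ.Vertex, Path w v => f (pathColor r.2) * y r.1).Finite :=
  (hf v).subset fun _ h => left_ne_zero_of_mul h

theorem act_add (y : FormalModule K Γ) {f g : FormalMonoidAlgebra K Γ.Color}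
    (hf : IsAdmissible f) (hg : IsAdmissible g) : act y (f + g) = act y f + act y g := by
  ext v
  simp only [act_apply, FormalModule.add_apply, FormalMonoidAlgebra.add_apply, add_mul]
  exact finsum_add_distrib (act_support_finite y hf v) (act_support_finite y hg v)

theorem add_act (y z : FormalModule K Γ) {f : FormalMonoidAlgebra K Γ.Color}
    (hf : IsAdmissible f) : act (y + z) f = act y f + act z f := by
  ext v
  simp only [act_apply, FormalModule.add_apply, mul_add]
  exact finsum_add_distrib (act_support_finite y hf v) (act_support_finite z hf v)

theorem act_one (y : FormalModule K Γ) : act y (1 : FormalMonoidAlgebra K Γ.Color) = y := by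
  ext v
  rw [act_apply, finsum_eq_single _ (⟨v, Path.nil⟩ : Σ w, Path w v)]
  · simp [one_apply]
  · rintro ⟨w, p⟩ hp
    have : pathColor p ≠ 1 := by
      intro h1
      have h2 : p.length = 0 := by rw [← length_pathColor, h1]; rfl
      obtain rfl := p.eq_of_length_zero h2
      obtain rfl := p.eq_nil_of_length_zero h2
      exact hp rfl
    simp [one_apply, this]

theorem act_mul (y : FormalModule K Γ) {f g : FormalMonoidAlgebra K Γ.Color}
    (hf : IsAdmissible f) (hg : IsAdmissible g) : act y (f * g) = act (act y f) g := by
  classical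
  ext v
  let S : Finset (Σ r : Σ w : Γ.Vertex, Path w v, Σ w : Γ.Vertex, Path w r.1) :=
    (hg v).toFinset.sigma fun r => (hf r.1).toFinset
  let φ : (Σ r : Σ w : Γ.Vertex, Path w v, Σ w : Γ.Vertex, Path w r.1) → Σ w, Path w v :=
    fun x => ⟨x.2.1, x.2.2.comp x.1.2⟩
  have hR : act (act y f) g v =
      ∑ x ∈ S, f (pathColor x.2.2) * g (pathColor x.1.2) * y x.2.1 := by
    rw [act_apply, finsum_eq_sum_of_support_subset (s := (hg v).toFinset) _ (by
      intro r h
      exact (hg v).mem_toFinset.2 (left_ne_zero_of_mul h)), Finset.sum_sigma]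
    refine Finset.sum_congr rfl fun r _ => ?_
    rw [act_apply, finsum_eq_sum_of_support_subset (s := (hf r.1).toFinset) _ (by
      intro q h
      exact (hf r.1).mem_toFinset.2 (left_ne_zero_of_mul h)), Finset.mul_sum]
    exact Finset.sum_congr rfl fun q _ => by ring
  have hL : act y (f * g) v = ∑ p ∈ S.image φ, (f * g) (pathColor p.2) * y p.1 := by
    rw [act_apply]
    refine finsum_eq_sum_of_support_subset _ ?_
    rintro ⟨w, p⟩ hp
    have hp' := left_ne_zero_of_mul hp
    obtain ⟨⟨a, b⟩, hab, hne⟩ := Finset.exists_ne_zero_of_sum_ne_zero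
      (show ∑ x ∈ splits (pathColor p), f x.1 * g x.2 ≠ 0 from hp')
    obtain ⟨x, q, r, rfl, rfl, rfl⟩ := exists_comp_of_pathColor p a b (mem_splits.1 hab).symm
    simp only [Finset.coe_image]
    refine ⟨⟨⟨x, r⟩, ⟨w, q⟩⟩, ?_, rfl⟩
    simp only [S, Finset.mem_coe, Finset.mem_sigma, Set.Finite.mem_toFinset]
    exact ⟨right_ne_zero_of_mul hne, left_ne_zero_of_mul hne⟩
  rw [hR, hL, ← Finset.sum_fiberwise_of_maps_to (g := φ) (t := S.image φ)
    fun x hx => Finset.mem_image_of_mem _ hx]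
  refine Finset.sum_congr rfl ?_
  rintro ⟨w, p⟩ -
  rw [mul_apply, Finset.sum_mul]
  symm
  refine Finset.sum_bij_ne_zero (fun x _ _ => (pathColor x.2.2, pathColor x.1.2)) ?_ ?_ ?_ ?_
  · rintro ⟨⟨x, r⟩, ⟨w', q⟩⟩ h -
    obtain ⟨-, h⟩ := Finset.mem_filter.1 h
    cases h
    simp [pathColor_comp]
  · rintro ⟨⟨x, r⟩, ⟨w₁, q⟩⟩ h - ⟨⟨x', r'⟩, ⟨w₂, q'⟩⟩ h' - he
    obtain ⟨-, h⟩ := Finset.mem_filter.1 h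
    obtain ⟨-, h'⟩ := Finset.mem_filter.1 h'
    obtain rfl : w₁ = w := congrArg Sigma.fst h
    obtain rfl : w₂ = w₁ := congrArg Sigma.fst h'
    have h1 : q.comp r = p := by simpa [φ] using h
    have h2 : q'.comp r' = p := by simpa [φ] using h'
    have := comp_unique (h1.trans h2.symm) (by
      rw [← length_pathColor, ← length_pathColor]
      exact congrArg FreeMonoid.length (Prod.ext_iff.1 he).2)
    cases this
    rfl
  · rintro ⟨a, b⟩ hab hne
    obtain ⟨x, q, r, rfl, rfl, rfl⟩ := exists_comp_of_pathColor p a b (mem_splits.1 hab).symm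
    have hne' := left_ne_zero_of_mul hne
    refine ⟨⟨⟨x, r⟩, ⟨w, q⟩⟩, ?_, hne, rfl⟩
    simp only [S, Finset.mem_filter, Finset.mem_sigma, Set.Finite.mem_toFinset]
    exact ⟨⟨right_ne_zero_of_mul hne', left_ne_zero_of_mul hne'⟩, rfl⟩
  · rintro ⟨⟨x, r⟩, ⟨w', q⟩⟩ h -
    obtain ⟨-, h⟩ := Finset.mem_filter.1 h
    cases h
    rfl

/-- The right `F_Γ`-module structure on `M_Γ`. -/
noncomputable instance : Module (admissibleAlgebra K Γ)ᵐᵒᵖ (FormalModule K Γ) where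
  smul f y := act y f.unop.1
  one_smul y := act_one y
  mul_smul f g y := act_mul y g.unop.2 f.unop.2
  smul_zero f := by
    ext v
    exact (finsum_congr fun r => mul_zero _).trans finsum_zero
  smul_add f y z := add_act y z f.unop.2
  add_smul f g y := act_add y f.unop.2 g.unop.2
  zero_smul y := by
    ext v
    exact (finsum_congr fun r => zero_mul _).trans finsum_zero

theorem op_smul_apply (f : (admissibleAlgebra K Γ)ᵐᵒᵖ) (y : FormalModule K Γ) (v : Γ.Vertex) :
    (f • y) v = ∑ᶠ r : Σ w : Γ.Vertex, Path w v, f.unop.1 (pathColor r.2) * y r.1 := rfl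

variable (K Γ) in
/-- The right `F_Γ`-module `M_Γ`, as an object of the category of right `F_Γ`-modules. -/
noncomputable def formalModule : ModuleCat.{u} (admissibleAlgebra K Γ)ᵐᵒᵖ :=
  ModuleCat.of _ (FormalModule K Γ)

variable (K Γ) in
/-- The full subcategory `G_Γ`: the smallest weakly closed subcategory of the category of right
`F_Γ`-modules that contains `M_Γ`. -/
abbrev Grothendieck : Type (u + 1) :=
  (weaklyClosedHull.{u} (formalModule K Γ)).FullSubcategory

variable (K Γ) in
/-- `M_Γ` as an object of `G_Γ`. -/
noncomputable def grothendieckModule : Grothendieck K Γ :=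
  ⟨formalModule K Γ, weaklyClosedHull_self _⟩

/-! ### The quiver `Γ̃` -/

variable (Γ) in
/-- The quiver `Γ̃`: copies `{i} × Γ` of `Γ` for all `i : ℕ` (with colors as in `Γ`), together with
an arrow `r^i_{v,w}` from `(i, v)` to `(i + 1, w)` of the new color `c_{v,w}` for all `i`, `v`,
`w`. -/
def tilde : ColoredQuiver.{u} where
  Vertex := ℕ × Γ.Vertex
  Arrow := (ℕ × Γ.Arrow) ⊕ (ℕ × Γ.Vertex × Γ.Vertex)
  Color := Γ.Color ⊕ (Γ.Vertex × Γ.Vertex)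
  src := Sum.elim (fun r => (r.1, Γ.src r.2)) (fun r => (r.1, r.2.1))
  tgt := Sum.elim (fun r => (r.1, Γ.tgt r.2)) (fun r => (r.1 + 1, r.2.2))
  col := Sum.elim (fun r => Sum.inl (Γ.col r.2)) (fun r => Sum.inr r.2)

variable (Γ) in
/-- The inclusion of the copy `{0} × Γ` into `Γ̃`. -/
def inclZero : Γ.Vertex ⥤q Γ.tilde.Vertex where
  obj v := ((0, v) : ℕ × Γ.Vertex)
  map r := ⟨Sum.inl (0, r.1), by
    obtain ⟨r, rfl, rfl⟩ := r
    exact ⟨rfl, rfl⟩⟩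

/-- The inclusion of free monoids `C* ⊆ C̃*`. -/
def colorIncl : FreeMonoid Γ.Color →* FreeMonoid Γ.tilde.Color :=
  FreeMonoid.map (Sum.inl : Γ.Color → Γ.Color ⊕ (Γ.Vertex × Γ.Vertex))

theorem colorIncl_injective : Function.Injective (colorIncl (Γ := Γ)) :=
  List.map_injective_iff.2 Sum.inl_injective

theorem colorIncl_eq_mul {c : FreeMonoid Γ.Color} {a b : FreeMonoid Γ.tilde.Color}
    (h : colorIncl c = a * b) : ∃ a' b', a' * b' = c ∧ colorIncl a' = a ∧ colorIncl b' = b := by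
  obtain ⟨a', b', h₁, h₂, h₃⟩ := List.map_eq_append_iff.1
    (show List.map Sum.inl c.toList = a.toList ++ b.toList from h)
  exact ⟨FreeMonoid.ofList a', FreeMonoid.ofList b', h₁.symm, h₂, h₃⟩

theorem pathColor_mapPath_inclZero {v w : Γ.Vertex} (p : Path v w) :
    pathColor ((inclZero Γ).mapPath p) = colorIncl (pathColor p) := by
  induction p with
  | nil => rfl
  | cons p r ih =>
    rw [Prefunctor.mapPath_cons, pathColor_cons, pathColor_cons, map_mul, ih]
    rfl

/-- The map on paths with a given target induced by the inclusion of `{0} × Γ` into `Γ̃`. -/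
def liftPath (w : Γ.Vertex) (p : Σ v : Γ.Vertex, Path v w) :
    Σ v : Γ.tilde.Vertex, Path v ((inclZero Γ).obj w) :=
  ⟨(inclZero Γ).obj p.1, (inclZero Γ).mapPath p.2⟩

theorem inclZero_obj_injective : Function.Injective (inclZero Γ).obj :=
  fun _ _ h => congrArg (fun x : ℕ × Γ.Vertex => x.2) h

theorem inclZero_map_injective {v w : Γ.Vertex} {r r' : v ⟶ w}
    (h : (inclZero Γ).map r = (inclZero Γ).map r') : r = r' := by
  have h1 : (Sum.inl (0, r.1) : (ℕ × Γ.Arrow) ⊕ (ℕ × Γ.Vertex × Γ.Vertex)) = Sum.inl (0, r'.1) :=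
    congrArg Subtype.val h
  have h2 : (0, r.1) = (0, r'.1) := Sum.inl_injective h1
  exact Subtype.ext (congrArg Prod.snd h2)

theorem liftPath_injective (w : Γ.Vertex) : Function.Injective (liftPath w) := by
  rintro ⟨v, p⟩ ⟨v', p'⟩ h
  obtain rfl : v = v' := inclZero_obj_injective (congrArg Sigma.fst h)
  replace h : (inclZero Γ).mapPath p = (inclZero Γ).mapPath p' := by
    simpa [liftPath] using h
  congr 1
  induction p with
  | nil =>
    cases p' with
    | nil => rfl
    | cons p' r' => simp at h
  | cons p r ih =>
    cases p' with
    | nil => simp at h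
    | cons p' r' =>
      simp only [Prefunctor.mapPath_cons, Path.cons.injEq] at h
      obtain ⟨h₀, h₁, h₂⟩ := h
      obtain rfl := inclZero_obj_injective h₀
      obtain rfl := ih _ (eq_of_heq h₁)
      obtain rfl := inclZero_map_injective (eq_of_heq h₂)
      rfl

theorem liftPath_surjective_aux {v u : Γ.tilde.Vertex} (p : Path v u) (w : Γ.Vertex)
    (h : u = (inclZero Γ).obj w) :
    ∃ q : Σ x : Γ.Vertex, Path x w, liftPath w q = ⟨v, h ▸ p⟩ := by
  induction p generalizing w with
  | nil =>
    subst h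
    exact ⟨⟨w, Path.nil⟩, rfl⟩
  | cons p r ih =>
    subst h
    obtain ⟨r | r, hr, hr'⟩ := r
    · obtain ⟨i, r⟩ := r
      obtain ⟨rfl, rfl⟩ : i = 0 ∧ Γ.tgt r = w := Prod.ext_iff.1 hr'
      subst hr
      obtain ⟨⟨x, q⟩, hq⟩ := ih (Γ.src r) rfl
      refine ⟨⟨x, q.cons ⟨r, rfl, rfl⟩⟩, ?_⟩
      cases hq
      rfl
    · exact absurd (congrArg (fun x : ℕ × Γ.Vertex => x.1) hr') (Nat.succ_ne_zero _)

theorem liftPath_bijective (w : Γ.Vertex) : Function.Bijective (liftPath w) :=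
  ⟨liftPath_injective w, fun p => liftPath_surjective_aux p.2 w rfl⟩

/-- The restriction of coefficients from `C̃*` to `C*`, as a ring homomorphism from
`K⟨⟨C̃⟩⟩` to `K⟨⟨C⟩⟩`. -/
noncomputable def restrictColors :
    FormalMonoidAlgebra K Γ.tilde.Color →+* FormalMonoidAlgebra K Γ.Color where
  toFun f := fun c => f (colorIncl c)
  map_zero' := rfl
  map_add' _ _ := rfl
  map_one' := by
    classical
    ext c
    rw [one_apply]
    show (1 : FormalMonoidAlgebra K Γ.tilde.Color) (colorIncl c) = _
    rw [one_apply]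
    simp only [map_eq_one_iff _ colorIncl_injective]
    rw [one_apply]
  map_mul' f g := by
    ext c
    rw [mul_apply]
    show (f * g) (colorIncl c) = _
    rw [mul_apply]
    symm
    refine Finset.sum_bij (fun x _ => (colorIncl x.1, colorIncl x.2)) ?_ ?_ ?_ ?_
    · intro x hx
      rw [mem_splits] at hx ⊢
      rw [← map_mul, hx]
    · rintro ⟨a, b⟩ - ⟨a', b'⟩ - h
      exact Prod.ext (colorIncl_injective (congrArg Prod.fst h))
        (colorIncl_injective (congrArg Prod.snd h))
    · rintro ⟨a, b⟩ h
      obtain ⟨a', b', hab, rfl, rfl⟩ := colorIncl_eq_mul (mem_splits.1 h).symm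
      exact ⟨(a', b'), mem_splits.2 hab, rfl⟩
    · intro x _
      rfl

theorem restrictColors_apply (f : FormalMonoidAlgebra K Γ.tilde.Color) (c : FreeMonoid Γ.Color) :
    restrictColors f c = f (colorIncl c) := rfl

theorem isAdmissible_restrictColors {f : FormalMonoidAlgebra K Γ.tilde.Color}
    (hf : IsAdmissible f) : IsAdmissible (restrictColors f) := by
  intro w
  refine ((hf ((inclZero Γ).obj w)).preimage (liftPath_injective w).injOn).subset ?_
  intro p hp
  show f (pathColor ((inclZero Γ).mapPath p.2)) ≠ 0
  rw [pathColor_mapPath_inclZero]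
  exact hp

variable (K Γ) in
/-- The canonical (surjective) ring homomorphism from `F_Γ̃` to `F_Γ`. -/
noncomputable def projection : admissibleAlgebra K Γ.tilde →+* admissibleAlgebra K Γ where
  toFun f := ⟨restrictColors f.1, isAdmissible_restrictColors f.2⟩
  map_zero' := rfl
  map_add' _ _ := rfl
  map_one' := Subtype.ext (map_one restrictColors)
  map_mul' f g := Subtype.ext (map_mul restrictColors f.1 g.1)

variable (K Γ) in
/-- The inclusion of the category of right `F_Γ`-modules into the category of right
`F_Γ̃`-modules. -/
noncomputable abbrev modInclusion :
    ModuleCat.{u} (admissibleAlgebra K Γ)ᵐᵒᵖ ⥤ ModuleCat.{u} (admissibleAlgebra K Γ.tilde)ᵐᵒᵖ :=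
  ModuleCat.restrictScalars (projection K Γ).op

variable (K Γ) in
/-- The projection from `M_Γ̃` onto its quotient `M_Γ`, the coefficients on `{0} × Γ`. -/
noncomputable def moduleProjection :
    formalModule K Γ.tilde ⟶ (modInclusion K Γ).obj (formalModule K Γ) :=
  ModuleCat.ofHom (Y := (modInclusion K Γ).obj (formalModule K Γ))
    { toFun := fun y : FormalModule K Γ.tilde =>
        (fun v => y ((inclZero Γ).obj v) : FormalModule K Γ)
      map_add' := fun _ _ => rfl
      map_smul' := fun f y => by
        refine FormalModule.ext (K := K) (Γ := Γ) fun w => ?_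
        refine (finsum_eq_of_bijective (liftPath w) (liftPath_bijective w) fun p => ?_).symm
        show f.unop.1 (colorIncl (pathColor p.2)) * _ =
          f.unop.1 (pathColor ((inclZero Γ).mapPath p.2)) * _
        rw [pathColor_mapPath_inclZero]
        rfl }

instance : Epi (moduleProjection K Γ) := by
  rw [ModuleCat.epi_iff_surjective]
  intro y
  exact ⟨fun v : ℕ × Γ.Vertex => (show FormalModule K Γ from y) v.2, rfl⟩

theorem grothendieck_le : weaklyClosedHull.{u} (formalModule K Γ) ≤
    (weaklyClosedHull.{u} (formalModule K Γ.tilde)).inverseImage (modInclusion K Γ) := by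
  intro X hX
  refine hX _ ?_ ((weaklyClosedHull.{u} (formalModule K Γ.tilde)).prop_of_epi
    (moduleProjection K Γ) (weaklyClosedHull_self _))
  exact
    { isClosedUnderCoproducts := fun J => by
        have := IsWeaklyClosed.isClosedUnderCoproducts
          (P := weaklyClosedHull.{u} (formalModule K Γ.tilde)) J
        infer_instance }

variable (K Γ) in
/-- The inclusion of `G_Γ` into `G_Γ̃`. -/
noncomputable def inclusion : Grothendieck K Γ ⥤ Grothendieck K Γ.tilde :=
  ObjectProperty.lift _ (ObjectProperty.ι _ ⋙ modInclusion K Γ) fun X => grothendieck_le _ X.2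

end ColoredQuiver

/-!
Write `M_≥n` for the submodule of `M_Γ̃` consisting of the elements supported in the levels `≥ n`.
It is the image of the `n`-th power of the shift, an injective endomorphism of `M_Γ̃`, hence a copy
of `M_Γ̃`; and `M_≥n / M_≥(n+1)` is a copy of `M_Γ`, because the image of the shift is the kernel of
the projection onto `M_Γ`. Everything rests on one computation
(`ColoredQuiver.exists_range_shift_pow_le_span`): each nonzero submodule of `M_Γ̃` contains some
`M_≥n`. Indeed, the formal sums of the words `c_{v,v}^n c_{v,w}` act on the family of coefficients
of an element at the vertices `(i, v)` by multiplication of power series, and a power series with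
nonzero constant coefficient is invertible.

It follows that `M_Γ̃` is compressible, and that it is noetherian, as the quotients by the `M_≥n`
have finite filtrations with factors `M_Γ`. It is monoform because each proper quotient is
annihilated by a power of the scalar `∑ c_{v,w}` (sum over `w`), while no nonzero subobject is.

The objects of the weakly closed hull of a module `M` over a ring `R` are controlled by two
properties that hold for `M` and pass to submodules, quotients and direct sums: the cyclic
submodules are noetherian if `M` is (`isLocallyNoetherian`), and each nonzero subquotient contains a
nonzero subquotient of `M` (`hasCyclicSubquotients`). The first one yields a generating family of
noetherian objects, and the second one reduces questions on arbitrary objects to subquotients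
`A / B` of `M`. For `M_Γ̃`, if `B = 0`, then `A` contains a copy of `M_Γ̃`; otherwise `B` contains
some `M_≥n`, and `A / B` contains a nonzero subquotient of one of the factors `M_≥k / M_≥(k+1)`.
Thus every nonzero object of `G_Γ̃` contains a copy of `M_Γ̃` or a nonzero object of `G_Γ`
(`ColoredQuiver.exists_mono_grothendieckModule_or_inclusion`), which gives the compressible
subobjects and the list of atoms.

Since `F_Γ̃ → F_Γ` is surjective, `G_Γ → G_Γ̃` is fully faithful and exact with essential image
closed under subobjects and quotients (`IsSubquotientClosedEmbedding`), and such functors induce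
order embeddings of atom spectra. Finally, an object with the atom of `M_Γ̃` in its support has
`M_Γ̃`, hence `M_Γ`, as a subquotient, and every atom of `G_Γ` lies in the support of `M_Γ`; the two
kinds of atoms differ because `∑ c_{v,w}` annihilates the objects of `G_Γ`.
-/

/-! ### Atoms in terms of morphisms -/

section AtomSpectrum

variable {C : Type u} [Category.{v} C]

theorem IsSubquotient.of_mono {X M : C} (i : X ⟶ M) [Mono i] : IsSubquotient X M :=
  isSubquotient_iff.2 ⟨X, i, 𝟙 X, inferInstance, inferInstance⟩

theorem IsSubquotient.of_epi {X M : C} (p : M ⟶ X) [Epi p] : IsSubquotient X M :=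
  isSubquotient_iff.2 ⟨M, 𝟙 M, p, inferInstance, inferInstance⟩

variable [Abelian C]

theorem isCompressible_iff {H : C} : IsCompressible H ↔ ¬ IsZero H ∧
    ∀ (L : C) (i : L ⟶ H) [Mono i], ¬ IsZero L → ∃ j : H ⟶ L, Mono j := by
  refine and_congr_right fun _ => ⟨fun h L i _ hL => ?_, fun h L hL => ?_⟩
  · obtain ⟨N, hN, ⟨e⟩⟩ := h (Subobject.mk i) fun h0 =>
      hL (IsZero.of_mono_eq_zero i (Subobject.mk_eq_bot_iff_zero.1 h0))
    exact ⟨e.inv ≫ Subobject.ofLE _ _ hN ≫ (Subobject.underlyingIso i).hom, inferInstance⟩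
  · obtain ⟨j, _⟩ := h _ L.arrow ((subobject_ne_bot_iff L).1 hL)
    exact ⟨Subobject.mk (j ≫ L.arrow), Subobject.mk_le_of_comm j rfl,
      ⟨Subobject.underlyingIso (j ≫ L.arrow)⟩⟩

theorem isMonoform_iff {H : C} : IsMonoform H ↔ ¬ IsZero H ∧
    ∀ (Q X : C) (q : H ⟶ Q) (i : X ⟶ H) (j : X ⟶ Q) [Epi q] [Mono i] [Mono j],
      ¬ IsZero X → Mono q := by
  refine ⟨fun h => ⟨h.1, fun Q X q i j _ _ _ hX => h.mono_of_epi q i j hX⟩,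
    fun h => ⟨h.1, ?_⟩⟩
  rintro L hL N ⟨N', ⟨e⟩⟩
  by_contra hN
  have := h.2 _ _ (cokernel.π L.arrow) N.arrow (e.hom ≫ N'.arrow) ((subobject_ne_bot_iff N).1 hN)
  refine (subobject_ne_bot_iff L).1 hL (IsZero.of_mono_eq_zero L.arrow ?_)
  rw [← cancel_mono (cokernel.π L.arrow), cokernel.condition, zero_comp]

theorem IsCompressible.of_iso {H H' : C} (h : IsCompressible H) (e : H ≅ H') :
    IsCompressible H' := by
  rw [isCompressible_iff] at h ⊢
  refine ⟨fun h0 => h.1 (h0.of_iso e), fun L i _ hL => ?_⟩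
  obtain ⟨j, _⟩ := h.2 L (i ≫ e.inv) hL
  exact ⟨e.inv ≫ j, inferInstance⟩

theorem IsMonoform.of_mono {H L : C} (h : IsMonoform H) (i : L ⟶ H) [Mono i] (hL : ¬ IsZero L) :
    IsMonoform L := by
  refine isMonoform_iff.2 ⟨hL, fun Q X q k j _ _ _ hX => ?_⟩
  have := h.mono_of_epi (pushout.inl i q) (k ≫ i) (j ≫ pushout.inr i q) hX
  exact mono_of_mono_fac (pushout.condition (f := i) (g := q)).symm

theorem AtomEquivalent.of_mono {H L : C} (i : L ⟶ H) [Mono i] (hL : ¬ IsZero L) :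
    AtomEquivalent L H :=
  atomEquivalent_iff.2 ⟨L, 𝟙 L, i, inferInstance, inferInstance, hL⟩

theorem IsSubquotient.trans {X Y Z : C} (h : IsSubquotient X Y) (h' : IsSubquotient Y Z) :
    IsSubquotient X Z := by
  obtain ⟨L, i, p, _, _⟩ := isSubquotient_iff.1 h
  obtain ⟨L', i', p', _, _⟩ := isSubquotient_iff.1 h'
  exact isSubquotient_iff.2 ⟨pullback i p', pullback.snd i p' ≫ i', pullback.fst i p' ≫ p,
    inferInstance, inferInstance⟩

/-- The atom of `H` lies in the support of `M` exactly when a nonzero subobject of `H` is a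
subquotient of `M`. -/
theorem atom_mem_ASupp_iff {H M : C} (h : IsMonoform H) : atom H h ∈ ASupp M ↔
    ∃ (L : C) (i : L ⟶ H), Mono i ∧ ¬ IsZero L ∧ IsSubquotient L M := by
  constructor
  · rintro ⟨H', h', hs, he⟩
    obtain ⟨X, i, j, _, _, hX⟩ := atomEquivalent_iff.1 (atom_eq_iff.1 he)
    exact ⟨X, j, inferInstance, hX, (IsSubquotient.of_mono i).trans hs⟩
  · rintro ⟨L, i, _, hL, hs⟩
    exact ⟨L, h.of_mono i hL, hs, atom_eq_iff.2 (AtomEquivalent.of_mono i hL)⟩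

theorem atom_le_atom_iff {H₁ H₂ : C} {h₁ : IsMonoform H₁} {h₂ : IsMonoform H₂} :
    atom H₁ h₁ ≤ atom H₂ h₂ ↔ ∀ M : C, atom H₁ h₁ ∈ ASupp M → atom H₂ h₂ ∈ ASupp M :=
  mem_localizingClosure_singleton

end AtomSpectrum

/-! ### Atoms under the inclusion of a weakly closed subcategory -/

section FullyFaithful

variable {C : Type u} [Category.{v} C] [Abelian C] {D : Type*} [Category* D] [Abelian D]

/-- A fully faithful functor that preserves monomorphisms, epimorphisms and zero morphisms and
whose essential image is closed under subobjects and quotients. Up to equivalence, this is the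
inclusion of a full subcategory closed under subobjects and quotients. -/
class IsSubquotientClosedEmbedding (F : C ⥤ D) : Prop where
  full : F.Full
  faithful : F.Faithful
  preservesMonomorphisms : F.PreservesMonomorphisms
  preservesEpimorphisms : F.PreservesEpimorphisms
  preservesZeroMorphisms : F.PreservesZeroMorphisms
  exists_iso_of_mono : ∀ {Y : C} {Z : D} (i : Z ⟶ F.obj Y) [Mono i], ∃ Y', Nonempty (F.obj Y' ≅ Z)
  exists_iso_of_epi : ∀ {Y : C} {Z : D} (p : F.obj Y ⟶ Z) [Epi p], ∃ Y', Nonempty (F.obj Y' ≅ Z)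

namespace IsSubquotientClosedEmbedding

attribute [instance] full faithful preservesMonomorphisms preservesEpimorphisms
  preservesZeroMorphisms

variable {F : C ⥤ D} [IsSubquotientClosedEmbedding F]

theorem isZero_iff {Y : C} : IsZero (F.obj Y) ↔ IsZero Y := by
  rw [IsZero.iff_id_eq_zero, IsZero.iff_id_eq_zero, ← F.map_id, F.map_eq_zero_iff]

/-- Each subobject of an object in the image comes from a subobject in the source. -/
theorem exists_mono {Y : C} {Z : D} (i : Z ⟶ F.obj Y) [Mono i] :
    ∃ (Y' : C) (i' : Y' ⟶ Y) (e : F.obj Y' ≅ Z), Mono i' ∧ F.map i' = e.hom ≫ i := by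
  obtain ⟨Y', ⟨e⟩⟩ := exists_iso_of_mono i
  refine ⟨Y', F.preimage (e.hom ≫ i), e, F.mono_of_mono_map ?_, F.map_preimage _⟩
  rw [F.map_preimage]
  infer_instance

/-- Each quotient of an object in the image comes from a quotient in the source. -/
theorem exists_epi {Y : C} {Z : D} (p : F.obj Y ⟶ Z) [Epi p] :
    ∃ (Y' : C) (p' : Y ⟶ Y') (e : Z ≅ F.obj Y'), Epi p' ∧ F.map p' = p ≫ e.hom := by
  obtain ⟨Y', ⟨e⟩⟩ := exists_iso_of_epi p
  refine ⟨Y', F.preimage (p ≫ e.inv), e.symm, F.epi_of_epi_map ?_, F.map_preimage _⟩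
  rw [F.map_preimage]
  infer_instance

theorem isCompressible_map {H : C} (h : IsCompressible H) : IsCompressible (F.obj H) := by
  rw [isCompressible_iff] at h ⊢
  refine ⟨fun h0 => h.1 (isZero_iff.1 h0), fun L i _ hL => ?_⟩
  obtain ⟨L', i', e, _, -⟩ := exists_mono i
  obtain ⟨j, _⟩ := h.2 L' i' fun h0 => hL ((isZero_iff (F := F).2 h0).of_iso e.symm)
  exact ⟨F.map j ≫ e.hom, inferInstance⟩

theorem isMonoform_map {H : C} (h : IsMonoform H) : IsMonoform (F.obj H) := by
  refine isMonoform_iff.2 ⟨fun h0 => h.1 (isZero_iff.1 h0), fun Q X q i j _ _ _ hX => ?_⟩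
  obtain ⟨X', i', e, _, -⟩ := exists_mono i
  obtain ⟨Q', q', e', _, hq⟩ := exists_epi q
  have : Mono (F.preimage (e.hom ≫ j ≫ e'.hom)) := by
    refine F.mono_of_mono_map ?_
    rw [F.map_preimage]
    infer_instance
  have := h.mono_of_epi q' i' (F.preimage (e.hom ≫ j ≫ e'.hom))
    fun h0 => hX ((isZero_iff (F := F).2 h0).of_iso e.symm)
  exact mono_of_mono_fac hq.symm

theorem isMonoform_of_map {H : C} (h : IsMonoform (F.obj H)) : IsMonoform H := by
  refine isMonoform_iff.2 ⟨fun h0 => h.1 (isZero_iff.2 h0), fun Q X q i j _ _ _ hX => ?_⟩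
  have := h.mono_of_epi (F.map q) (F.map i) (F.map j) fun h0 => hX (isZero_iff.1 h0)
  exact F.mono_of_mono_map this

variable (F) in
theorem atomEquivalent_map_iff {H₁ H₂ : C} :
    AtomEquivalent (F.obj H₁) (F.obj H₂) ↔ AtomEquivalent H₁ H₂ := by
  rw [atomEquivalent_iff, atomEquivalent_iff]
  constructor
  · rintro ⟨X, i, j, _, _, hX⟩
    obtain ⟨X', i', e, _, -⟩ := exists_mono i
    refine ⟨X', i', F.preimage (e.hom ≫ j), inferInstance, F.mono_of_mono_map ?_,
      fun h0 => hX ((isZero_iff (F := F).2 h0).of_iso e.symm)⟩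
    rw [F.map_preimage]
    infer_instance
  · rintro ⟨X, i, j, _, _, hX⟩
    exact ⟨F.obj X, F.map i, F.map j, inferInstance, inferInstance,
      fun h0 => hX (isZero_iff.1 h0)⟩

theorem isSubquotient_map {X Y : C} (h : IsSubquotient X Y) :
    IsSubquotient (F.obj X) (F.obj Y) := by
  obtain ⟨L, i, p, _, _⟩ := isSubquotient_iff.1 h
  exact isSubquotient_iff.2 ⟨F.obj L, F.map i, F.map p, inferInstance, inferInstance⟩

theorem isSubquotient_of_map {X Y : C} (h : IsSubquotient (F.obj X) (F.obj Y)) :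
    IsSubquotient X Y := by
  obtain ⟨L, i, p, _, _⟩ := isSubquotient_iff.1 h
  obtain ⟨L', i', e, _, -⟩ := exists_mono i
  refine isSubquotient_iff.2 ⟨L', i', F.preimage (e.hom ≫ p), inferInstance,
    F.epi_of_epi_map ?_⟩
  rw [F.map_preimage]
  infer_instance

/-- Membership in atom supports does not depend on the category in which it is tested. -/
theorem atom_map_mem_ASupp_iff {H Y : C} (h : IsMonoform H) :
    atom (F.obj H) (isMonoform_map h) ∈ ASupp (F.obj Y) ↔ atom H h ∈ ASupp Y := by
  rw [atom_mem_ASupp_iff, atom_mem_ASupp_iff]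
  constructor
  · rintro ⟨L, i, _, hL, hs⟩
    obtain ⟨L', i', e, _, -⟩ := exists_mono i
    exact ⟨L', i', inferInstance, fun h0 => hL ((isZero_iff (F := F).2 h0).of_iso e.symm),
      isSubquotient_of_map (F := F) ((IsSubquotient.of_mono e.hom).trans hs)⟩
  · rintro ⟨L, i, _, hL, hs⟩
    exact ⟨F.obj L, F.map i, inferInstance, fun h0 => hL (isZero_iff.1 h0), isSubquotient_map hs⟩

theorem atom_map_le_atom_map_iff {H₁ H₂ : C} (h₁ : IsMonoform H₁) (h₂ : IsMonoform H₂) :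
    atom (F.obj H₁) (isMonoform_map h₁) ≤ atom (F.obj H₂) (isMonoform_map h₂) ↔
      atom H₁ h₁ ≤ atom H₂ h₂ := by
  rw [atom_le_atom_iff, atom_le_atom_iff]
  refine ⟨fun h Y hY => ?_, fun h X hX => ?_⟩
  · exact (atom_map_mem_ASupp_iff (F := F) h₂).1 (h _ ((atom_map_mem_ASupp_iff h₁).2 hY))
  · obtain ⟨L, i, _, hL, hs⟩ := (atom_mem_ASupp_iff _).1 hX
    obtain ⟨L', i', e, _, -⟩ := exists_mono i
    have hL' : ¬ IsZero L' := fun h0 => hL ((isZero_iff (F := F).2 h0).of_iso e.symm)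
    obtain ⟨N, k, _, hN, hs'⟩ := (atom_mem_ASupp_iff _).1 <| (atom_map_mem_ASupp_iff (F := F) h₂).2
      (h L' ((atom_mem_ASupp_iff h₁).2 ⟨L', i', inferInstance, hL', .of_mono (𝟙 _)⟩))
    exact (atom_mem_ASupp_iff _).2 ⟨N, k, inferInstance, hN,
      (hs'.trans (.of_mono e.hom)).trans hs⟩

variable (F) in
/-- The order embedding of atom spectra that sends the atom of `H` to the atom of `F H`. -/
def aspecEmbedding : ASpec C ↪o ASpec D :=
  OrderEmbedding.ofMapLEIff
    (Quotient.map (sa := atomSetoid C) (sb := atomSetoid D)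
      (fun H => ⟨F.obj H.1, isMonoform_map H.2⟩)
      (fun _ _ h => (atomEquivalent_map_iff F).2 h)) fun α β => by
    obtain ⟨H₁, h₁, rfl⟩ := atom_surjective α
    obtain ⟨H₂, h₂, rfl⟩ := atom_surjective β
    exact atom_map_le_atom_map_iff h₁ h₂

variable (F) in
theorem aspecEmbedding_atom (H : C) (h : IsMonoform H) :
    aspecEmbedding F (atom H h) = atom (F.obj H) (isMonoform_map h) := rfl

end IsSubquotientClosedEmbedding

end FullyFaithful

/-! ### Weakly closed subcategories of module categories -/

section ModuleCategory

open DirectSum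

variable {R : Type u} [Ring R]

theorem isWeaklyClosed_of_directSum (P : ObjectProperty (ModuleCat.{u} R))
    [P.IsClosedUnderSubobjects] [P.IsClosedUnderQuotients]
    (h : ∀ (J : Type u) (Z : J → ModuleCat.{u} R), (∀ j, P (Z j)) →
      P (ModuleCat.of R (⨁ j, Z j))) : IsWeaklyClosed.{u} P where
  isClosedUnderCoproducts J :=
    { colimitsOfShape_le := by
        classical
        rintro X ⟨c⟩
        exact P.prop_of_iso (IsColimit.coconePointsIsoOfNatIso
          (ModuleCat.coproductCoconeIsColimit fun j => c.diag.obj ⟨j⟩) c.isColimit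
          Discrete.natIsoFunctor.symm) (h J _ fun j => c.prop_diag_obj ⟨j⟩) }

/-- Every element of `X` generates a noetherian submodule. -/
def isLocallyNoetherian : ObjectProperty (ModuleCat.{u} R) :=
  fun X => ∀ x : X, IsNoetherian R (Submodule.span R {x})

instance : (isLocallyNoetherian (R := R)).IsClosedUnderSubobjects where
  prop_of_mono {X Y} f _ hY x := by
    have hf := (ModuleCat.mono_iff_injective f).1 inferInstance
    have := hY (f x)
    refine isNoetherian_of_injective (f.hom.restrict (p := Submodule.span R {x})
      (q := Submodule.span R {f x}) fun y hy => ?_) fun a b hab =>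
        Subtype.ext (hf (congrArg Subtype.val hab))
    obtain ⟨r, rfl⟩ := Submodule.mem_span_singleton.1 hy
    exact Submodule.mem_span_singleton.2 ⟨r, (map_smul f.hom r x).symm⟩

instance : (isLocallyNoetherian (R := R)).IsClosedUnderQuotients where
  prop_of_epi {X Y} f _ hX y := by
    obtain ⟨x, rfl⟩ := (ModuleCat.epi_iff_surjective f).1 inferInstance y
    have := hX x
    have h : Submodule.span R {f x} = (Submodule.span R {x}).map f.hom := by
      rw [Submodule.map_span, Set.image_singleton]
    rw [h]
    infer_instance

instance : IsWeaklyClosed.{u} (isLocallyNoetherian (R := R)) := by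
  classical
  refine isWeaklyClosed_of_directSum _ fun J Z hZ (x : ⨁ j, Z j) => ?_
  induction x using DirectSum.induction_on with
  | zero =>
    rw [Submodule.span_zero_singleton]
    infer_instance
  | of j z =>
    have := hZ j z
    have h : Submodule.span R {DirectSum.of (fun j => Z j) j z} =
        (Submodule.span R {z}).map (DirectSum.lof R J (fun j => Z j) j) := by
      rw [Submodule.map_span, Set.image_singleton]
      rfl
    rw [h]
    infer_instance
  | add x y hx hy =>
    refine isNoetherian_of_le (t := Submodule.span R {x} ⊔ Submodule.span R {y}) ?_
    rw [Submodule.span_singleton_le_iff_mem]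
    exact Submodule.add_mem_sup (Submodule.mem_span_singleton_self x)
      (Submodule.mem_span_singleton_self y)

/-- Each nonzero subquotient of `X` contains a nonzero cyclic submodule that is a subquotient of
`M`. This is expressed by annihilators: the image of `r • x` in `X ⧸ B` and the image of `m` in
`M ⧸ B'` have the same annihilator. -/
def hasCyclicSubquotients (M : ModuleCat.{u} R) : ObjectProperty (ModuleCat.{u} R) :=
  fun X => ∀ (B : Submodule R X) (x : X), x ∉ B → ∃ r : R, r • x ∉ B ∧
    ∃ (B' : Submodule R M) (m : M), ∀ s : R, s • r • x ∈ B ↔ s • m ∈ B'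

variable (M : ModuleCat.{u} R)

theorem hasCyclicSubquotients_self : hasCyclicSubquotients M M :=
  fun B x hx => ⟨1, by rwa [one_smul], B, x, fun s => by rw [one_smul]⟩

instance : (hasCyclicSubquotients M).IsClosedUnderSubobjects where
  prop_of_mono {X Y} f _ hY B x hx := by
    have hf := (ModuleCat.mono_iff_injective f).1 inferInstance
    have key (y : X) : f y ∈ B.map f.hom ↔ y ∈ B :=
      ⟨fun ⟨z, hz, h⟩ => hf h ▸ hz, fun h => ⟨y, h, rfl⟩⟩
    obtain ⟨r, hr, B', m, h⟩ := hY (B.map f.hom) (f x) (by rwa [key])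
    refine ⟨r, fun h0 => hr ?_, B', m, fun s => ?_⟩
    · rw [← map_smul]
      exact (key _).2 h0
    · rw [← h, ← map_smul, ← map_smul, key]

instance : (hasCyclicSubquotients M).IsClosedUnderQuotients where
  prop_of_epi {X Y} f _ hX B y hy := by
    obtain ⟨x, rfl⟩ := (ModuleCat.epi_iff_surjective f).1 inferInstance y
    obtain ⟨r, hr, B', m, h⟩ := hX (B.comap f.hom) x hy
    refine ⟨r, fun h0 => hr ?_, B', m, fun s => ?_⟩
    · rwa [Submodule.mem_comap, map_smul]
    · rw [← h, Submodule.mem_comap, map_smul, map_smul]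

instance : IsWeaklyClosed.{u} (hasCyclicSubquotients M) := by
  classical
  refine isWeaklyClosed_of_directSum _ fun J Z hZ B (x : ⨁ j, Z j) hx => ?_
  -- Among the multiples of `x` outside `B`, choose one whose support is as small as possible.
  let p : ℕ → Prop := fun n => ∃ r : R, r • x ∉ B ∧ (DFinsupp.support (r • x)).card = n
  have hp : ∃ n, p n := ⟨_, 1, by rwa [one_smul], rfl⟩
  obtain ⟨r, hr, hn⟩ := Nat.find_spec hp
  have hmin (t : R) (ht : (DFinsupp.support (t • r • x)).card < (DFinsupp.support (r • x)).card) :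
      t • r • x ∈ B := by
    by_contra h
    rw [hn] at ht
    exact Nat.find_min hp ht ⟨t * r, by rwa [mul_smul], by rw [mul_smul]⟩
  have hne : (DFinsupp.support (r • x)).Nonempty := by
    rw [Finset.nonempty_iff_ne_empty, Ne, DFinsupp.support_eq_empty]
    intro h
    exact hr (h ▸ B.zero_mem)
  obtain ⟨j, hj⟩ := hne
  let π : (⨁ j, Z j) →ₗ[R] Z j := DirectSum.component R J (fun j => Z j) j
  have hker (t : R) (ht : π (t • r • x) = 0) : t • r • x ∈ B := by
    refine hmin t (Finset.card_lt_card (Finset.ssubset_iff_subset_ne.2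
      ⟨fun i hi => ?_, fun h => ?_⟩))
    · rw [DFinsupp.mem_support_iff] at hi ⊢
      intro h0
      refine hi ?_
      change t • (r • x) i = 0
      rw [h0, smul_zero]
    · rw [← h, DFinsupp.mem_support_iff] at hj
      exact hj ht
  -- Hence the annihilator of `r • x` modulo `B` can be computed in the coordinate `j`.
  have key (s : R) : s • r • x ∈ B ↔
      s • π (r • x) ∈ (Submodule.span R {r • x} ⊓ B).map π := by
    rw [← map_smul]
    refine ⟨fun h =>
      ⟨_, ⟨Submodule.smul_mem _ _ (Submodule.mem_span_singleton_self _), h⟩, rfl⟩, ?_⟩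
    rintro ⟨y, ⟨hy, hyB⟩, h⟩
    obtain ⟨t, rfl⟩ := Submodule.mem_span_singleton.1 hy
    have : (s - t) • r • x ∈ B := hker _ (by rw [sub_smul, map_sub, h, sub_self])
    rw [sub_smul] at this
    exact (Submodule.sub_mem_iff_left B hyB).1 this
  obtain ⟨r', hr', B', m, h⟩ := hZ j ((Submodule.span R {r • x} ⊓ B).map π) (π (r • x)) (by
    have := (key 1).not.1 (by rwa [one_smul])
    rwa [one_smul] at this)
  refine ⟨r' * r, ?_, B', m, fun s => ?_⟩
  · rw [mul_smul, key]
    exact hr'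
  · rw [mul_smul, ← h, ← mul_smul s r' (r • x), ← mul_smul s r' (π _), key]

variable {M} in
theorem hasCyclicSubquotients_of_weaklyClosedHull {X : ModuleCat.{u} R}
    (h : weaklyClosedHull.{u} M X) : hasCyclicSubquotients M X :=
  h _ inferInstance (hasCyclicSubquotients_self M)

variable {M} in
theorem isLocallyNoetherian_of_weaklyClosedHull [IsNoetherian R M] {X : ModuleCat.{u} R}
    (h : weaklyClosedHull.{u} M X) : isLocallyNoetherian X :=
  h _ inferInstance fun _ => inferInstance

end ModuleCategory

section FullSubcategory

variable {R : Type u} [Ring R] {M : ModuleCat.{u} R}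

instance (J : Type u) [SmallCategory J] :
    (weaklyClosedHull.{u} M).IsClosedUnderColimitsOfShape J where
  colimitsOfShape_le := by
    rintro X ⟨c⟩
    have := IsWeaklyClosed.isClosedUnderCoproducts (P := weaklyClosedHull.{u} M) J
    have : Epi (Sigma.desc fun j => c.ι.app j) :=
      ⟨fun g h hgh => c.isColimit.hom_ext fun j => by simpa using Sigma.ι c.diag.obj j ≫= hgh⟩
    exact (weaklyClosedHull.{u} M).prop_of_epi (Sigma.desc fun j => c.ι.app j)
      ((weaklyClosedHull.{u} M).prop_colimit (Discrete.functor c.diag.obj)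
        fun j => c.prop_diag_obj j.as)

theorem hull_isZero_iff (X : (weaklyClosedHull.{u} M).FullSubcategory) :
    IsZero X ↔ ∀ x : X.obj, x = 0 := by
  rw [IsZero.iff_id_eq_zero]
  constructor
  · intro h x
    exact congrArg (fun f => f.hom.hom x) h
  · intro h
    ext x
    exact h x

theorem hull_mono_iff {X Y : (weaklyClosedHull.{u} M).FullSubcategory} (f : X ⟶ Y) :
    Mono f ↔ Function.Injective f.hom.hom := by
  have := (weaklyClosedHull.{u} M).preservesMonomorphisms_ι_of_isNormalEpiCategory
  rw [← ModuleCat.mono_iff_injective]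
  exact ((weaklyClosedHull.{u} M).ι.mono_map_iff_mono f).symm

theorem hull_epi_iff {X Y : (weaklyClosedHull.{u} M).FullSubcategory} (f : X ⟶ Y) :
    Epi f ↔ Function.Surjective f.hom.hom := by
  have := (weaklyClosedHull.{u} M).preservesEpimorphisms_ι_of_isNormalMonoCategory
  rw [← ModuleCat.epi_iff_surjective]
  exact ((weaklyClosedHull.{u} M).ι.epi_map_iff_epi f).symm

/-- A submodule of an object of the weakly closed hull, as an object of the hull. -/
abbrev hullSubmodule {X : (weaklyClosedHull.{u} M).FullSubcategory} (N : Submodule R X.obj) :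
    (weaklyClosedHull.{u} M).FullSubcategory :=
  ⟨ModuleCat.of R N, by
    have := (ModuleCat.mono_iff_injective (ModuleCat.ofHom N.subtype)).2 N.subtype_injective
    exact (weaklyClosedHull.{u} M).prop_of_mono (ModuleCat.ofHom N.subtype) X.2⟩

/-- The inclusion of a submodule. -/
abbrev hullSubtype {X : (weaklyClosedHull.{u} M).FullSubcategory} (N : Submodule R X.obj) :
    hullSubmodule N ⟶ X :=
  ObjectProperty.homMk (ModuleCat.ofHom N.subtype)

instance {X : (weaklyClosedHull.{u} M).FullSubcategory} (N : Submodule R X.obj) :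
    Mono (hullSubtype N) :=
  (hull_mono_iff _).2 N.subtype_injective

theorem exists_factorization_of_range_le {X L L' : (weaklyClosedHull.{u} M).FullSubcategory}
    (i : L ⟶ X) (j : L' ⟶ X) [Mono j] (h : i.hom.hom.range ≤ j.hom.hom.range) :
    ∃ k : L ⟶ L', k ≫ j = i := by
  have hj := (hull_mono_iff j).1 inferInstance
  refine ⟨ObjectProperty.homMk (ModuleCat.ofHom ((LinearEquiv.ofInjective j.hom.hom hj).symm ∘ₗ
    i.hom.hom.codRestrict _ fun x => h ⟨x, rfl⟩)), ?_⟩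
  ext x
  exact congrArg Subtype.val ((LinearEquiv.ofInjective j.hom.hom hj).apply_symm_apply
    ⟨i.hom.hom x, h ⟨x, rfl⟩⟩)

theorem subobject_mk_le_mk_iff_range_le {X L L' : (weaklyClosedHull.{u} M).FullSubcategory}
    (i : L ⟶ X) (j : L' ⟶ X) [Mono i] [Mono j] :
    Subobject.mk i ≤ Subobject.mk j ↔ i.hom.hom.range ≤ j.hom.hom.range := by
  constructor
  · rintro h _ ⟨x, rfl⟩
    rw [← Subobject.ofMkLEMk_comp h]
    exact ⟨(Subobject.ofMkLEMk i j h).hom.hom x, rfl⟩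
  · intro h
    obtain ⟨k, hk⟩ := exists_factorization_of_range_le i j h
    exact Subobject.mk_le_mk_of_comm k hk

theorem isNoetherianObject_iff_isNoetherian (X : (weaklyClosedHull.{u} M).FullSubcategory) :
    IsNoetherianObject X ↔ IsNoetherian R X.obj := by
  rw [isNoetherian_iff']
  constructor
  · intro h
    let f : Submodule R X.obj ↪o Subobject X :=
      OrderEmbedding.ofMapLEIff (fun N => Subobject.mk (hullSubtype N)) fun N N' => by
        rw [subobject_mk_le_mk_iff_range_le]
        change N.subtype.range ≤ N'.subtype.range ↔ _
        rw [Submodule.range_subtype, Submodule.range_subtype]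
    exact f.strictMono.wellFoundedGT
  · intro h
    let f : Subobject X ↪o Submodule R X.obj :=
      OrderEmbedding.ofMapLEIff (fun L => L.arrow.hom.hom.range) fun L L' => by
        rw [← subobject_mk_le_mk_iff_range_le, Subobject.mk_arrow, Subobject.mk_arrow]
    exact ⟨f.strictMono.wellFoundedGT⟩

instance : HasFilteredColimitsOfSize.{u, u} (weaklyClosedHull.{u} M).FullSubcategory :=
  ⟨fun _ _ _ => inferInstance⟩

/-- The full subcategory on the weakly closed hull has exact filtered colimits, because they
agree with those of the category of modules. -/
theorem isGrothendieckAbelian_hull {ι : Type u}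
    (G : ι → (weaklyClosedHull.{u} M).FullSubcategory)
    (hG : (ObjectProperty.ofObj G).IsSeparating) :
    IsGrothendieckAbelian.{u} (weaklyClosedHull.{u} M).FullSubcategory where
  ab5OfSize := by
    have := (weaklyClosedHull.{u} M).preservesKernels_ι
    have := (weaklyClosedHull.{u} M).ι.preservesFiniteLimits_of_preservesKernels
    exact ⟨fun J _ _ => .domain_of_functor J (weaklyClosedHull.{u} M).ι⟩
  hasSeparator := ⟨_, hG.isSeparator_coproduct⟩

/-- If `M` is noetherian, then the noetherian cyclic modules in the weakly closed hull of `M` form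
a generating family: each element of an object generates such a module. -/
theorem isLocallyNoetherianGrothendieck_hull [IsNoetherian R M] :
    IsLocallyNoetherianGrothendieck.{u} (weaklyClosedHull.{u} M).FullSubcategory := by
  let ι := {I : Submodule R R //
    weaklyClosedHull.{u} M (ModuleCat.of R (R ⧸ I)) ∧ IsNoetherian R (R ⧸ I)}
  let G : ι → (weaklyClosedHull.{u} M).FullSubcategory := fun I => ⟨ModuleCat.of R (R ⧸ I.1), I.2.1⟩
  have hG : (ObjectProperty.ofObj G).IsSeparating := by
    intro X Y f g h
    ext x
    have := isLocallyNoetherian_of_weaklyClosedHull X.2 x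
    let p : R →ₗ[R] X.obj := LinearMap.toSpanSingleton R X.obj x
    let e : (R ⧸ p.ker) ≃ₗ[R] Submodule.span R {x} :=
      p.quotKerEquivRange ≪≫ₗ LinearEquiv.ofEq _ _ (LinearMap.range_toSpanSingleton x)
    have hI : weaklyClosedHull.{u} M (ModuleCat.of R (R ⧸ p.ker)) :=
      (weaklyClosedHull.{u} M).prop_of_iso e.symm.toModuleIso (hullSubmodule (X := X) _).2
    have := h (G ⟨p.ker, hI, isNoetherian_of_linearEquiv e.symm⟩) ⟨_⟩
      (ObjectProperty.homMk (ModuleCat.ofHom ((Submodule.subtype _) ∘ₗ e.toLinearMap)))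
    have := congrArg (fun k => k.hom.hom (p.ker.mkQ 1)) this
    have h1 : ((e (p.ker.mkQ 1) : Submodule.span R {x}) : X.obj) = x := one_smul R x
    change f.hom.hom (e (p.ker.mkQ 1) : Submodule.span R {x}) =
      g.hom.hom (e (p.ker.mkQ 1) : Submodule.span R {x}) at this
    rwa [h1] at this
  exact ⟨isGrothendieckAbelian_hull G hG, ι, G,
    fun I => (isNoetherianObject_iff_isNoetherian _).2 I.2.2, hG⟩

end FullSubcategory

/-! ### Restriction of scalars along a surjective ring homomorphism -/

section RestrictScalars

theorem exists_linearMap_span_singleton {R X Y : Type*} [Ring R] [AddCommGroup X] [Module R X]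
    [AddCommGroup Y] [Module R Y] {p : X} {q : Y} (h : ∀ r : R, r • p = 0 → r • q = 0) :
    ∃ f : Submodule.span R {p} →ₗ[R] Y, ∀ r : R,
      f ⟨r • p, Submodule.smul_mem _ r (Submodule.mem_span_singleton_self p)⟩ = r • q := by
  let P := LinearMap.toSpanSingleton R X p
  let Q := LinearMap.toSpanSingleton R Y q
  have hle : P.ker ≤ Q.ker := fun r hr => h r hr
  refine ⟨P.ker.liftQ Q hle ∘ₗ P.quotKerEquivRange.symm.toLinearMap ∘ₗ
    (LinearEquiv.ofEq _ _ (LinearMap.range_toSpanSingleton p).symm).toLinearMap, fun r => ?_⟩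
  have h1 : P.quotKerEquivRange (P.ker.mkQ r) = ⟨r • p, ⟨r, rfl⟩⟩ := rfl
  change P.ker.liftQ Q hle (P.quotKerEquivRange.symm ⟨r • p, ⟨r, rfl⟩⟩) = r • q
  rw [← h1, LinearEquiv.symm_apply_apply]
  rfl

variable {R S : Type u} [Ring R] [Ring S] {φ : R →+* S}

theorem full_restrictScalars (hφ : Function.Surjective φ) :
    (ModuleCat.restrictScalars.{u} φ).Full where
  map_surjective {X Y} f := by
    refine ⟨ModuleCat.ofHom
      { toFun := fun x => f x
        map_add' := fun x y => map_add f.hom x y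
        map_smul' := fun s x => ?_ }, rfl⟩
    obtain ⟨r, rfl⟩ := hφ s
    exact f.hom.map_smul r x

/-- A module annihilated by the kernel of a surjective ring homomorphism `φ` is a module over the
target of `φ`. -/
theorem exists_restrictScalars_iso (hφ : Function.Surjective φ) (X : ModuleCat.{u} R)
    (hX : ∀ r : R, φ r = 0 → ∀ x : X, r • x = 0) :
    ∃ X' : ModuleCat.{u} S, Nonempty ((ModuleCat.restrictScalars φ).obj X' ≅ X) := by
  have key {r r' : R} (h : φ r = φ r') (x : X) : r • x = r' • x := by
    rw [← sub_eq_zero, ← sub_smul]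
    exact hX _ (by rw [map_sub, h, sub_self]) x
  have hinv (s : S) : φ (Function.surjInv hφ s) = s := Function.surjInv_eq hφ s
  let inst : Module S X :=
    { smul := fun s x => Function.surjInv hφ s • x
      one_smul := fun x => (key (by rw [hinv, map_one]) x).trans (one_smul R x)
      mul_smul := fun s t x => (key (by rw [hinv, map_mul, hinv, hinv]) x).trans
        (mul_smul (Function.surjInv hφ s) (Function.surjInv hφ t) x)
      smul_zero := fun s => smul_zero (Function.surjInv hφ s)
      smul_add := fun s x y => smul_add (Function.surjInv hφ s) x y
      add_smul := fun s t x => (key (by rw [hinv, map_add, hinv, hinv]) x).trans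
        (add_smul (Function.surjInv hφ s) (Function.surjInv hφ t) x)
      zero_smul := fun x => (key (by rw [hinv, map_zero]) x).trans (zero_smul R x) }
  let e : (ModuleCat.restrictScalars φ).obj (ModuleCat.of S X) ≃ₗ[R] X :=
    { toFun := fun x => x
      invFun := fun x => x
      left_inv := fun _ => rfl
      right_inv := fun _ => rfl
      map_add' := fun _ _ => rfl
      map_smul' := fun r x => key (hinv (φ r)) x }
  exact ⟨ModuleCat.of S X, ⟨e.toModuleIso⟩⟩

theorem smul_eq_zero_of_mono {X : ModuleCat.{u} R} {Y : ModuleCat.{u} S}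
    (i : X ⟶ (ModuleCat.restrictScalars φ).obj Y) [Mono i] {r : R} (hr : φ r = 0) (x : X) :
    r • x = 0 := by
  apply (ModuleCat.mono_iff_injective i).1 inferInstance
  rw [map_smul, map_zero]
  change φ r • (show Y from i x) = 0
  rw [hr, zero_smul]

theorem smul_eq_zero_of_epi {X : ModuleCat.{u} R} {Y : ModuleCat.{u} S}
    (p : (ModuleCat.restrictScalars φ).obj Y ⟶ X) [Epi p] {r : R} (hr : φ r = 0) (x : X) :
    r • x = 0 := by
  obtain ⟨y, rfl⟩ := (ModuleCat.epi_iff_surjective p).1 inferInstance x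
  rw [← map_smul]
  change p (φ r • (show Y from y)) = 0
  rw [hr, zero_smul]
  exact map_zero p.hom

theorem isNoetherian_restrictScalars (hφ : Function.Surjective φ) (Y : ModuleCat.{u} S)
    [h : IsNoetherian S Y] : IsNoetherian R ((ModuleCat.restrictScalars φ).obj Y) := by
  rw [isNoetherian_iff'] at h ⊢
  let f : Submodule R ((ModuleCat.restrictScalars φ).obj Y) ↪o Submodule S Y :=
    OrderEmbedding.ofMapLEIff (fun N =>
      { carrier := {y | y ∈ N}
        add_mem' := fun ha hb => N.add_mem ha hb
        zero_mem' := N.zero_mem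
        smul_mem' := fun s y hy => by
          obtain ⟨r, rfl⟩ := hφ s
          exact N.smul_mem r hy }) fun N N' => Iff.rfl
  exact f.strictMono.wellFoundedGT

end RestrictScalars

namespace ColoredQuiver

variable {K : Type u} [Field K] {Γ : ColoredQuiver.{u}}

/-- The inclusion of `G_Γ` into `G_Γ̃` identifies `G_Γ` with a full subcategory closed under
subobjects and quotients. -/
theorem isSubquotientClosedEmbedding_inclusion (h : Function.Surjective (projection K Γ).op) :
    IsSubquotientClosedEmbedding (inclusion K Γ) := by
  have : (modInclusion K Γ).Full := full_restrictScalars h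
  have hfull : (inclusion K Γ).Full :=
    ⟨fun f => ⟨ObjectProperty.homMk ((modInclusion K Γ).preimage f.hom), by
      ext x
      exact congrArg (fun g => g.hom x) ((modInclusion K Γ).map_preimage f.hom)⟩⟩
  have hfaith : (inclusion K Γ).Faithful :=
    ⟨fun {_ _ f g} hfg => by
      ext x
      exact congrArg (fun k => k.hom.hom x) hfg⟩
  have key {X : ModuleCat.{u} (admissibleAlgebra K Γ.tilde)ᵐᵒᵖ} := exists_restrictScalars_iso h X
  exact
    { full := hfull
      faithful := hfaith
      preservesMonomorphisms := ⟨fun f hf => (hull_mono_iff _).2 ((hull_mono_iff f).1 hf)⟩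
      preservesEpimorphisms := ⟨fun f hf => (hull_epi_iff _).2 ((hull_epi_iff f).1 hf)⟩
      preservesZeroMorphisms := ⟨fun _ _ => rfl⟩
      exists_iso_of_mono := fun {Y Z} i _ => by
        let j : Z.obj ⟶ (modInclusion K Γ).obj Y.obj := i.hom
        have hi : Mono j := (ModuleCat.mono_iff_injective _).2 ((hull_mono_iff i).1 inferInstance)
        obtain ⟨X', ⟨e⟩⟩ := key fun r hr x => smul_eq_zero_of_mono j hr x
        have : Mono ((modInclusion K Γ).preimage (e.hom ≫ j)) := by
          refine (modInclusion K Γ).mono_of_mono_map ?_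
          rw [Functor.map_preimage]
          infer_instance
        exact ⟨⟨X', ObjectProperty.prop_of_mono _
          ((modInclusion K Γ).preimage (e.hom ≫ j)) Y.2⟩, ⟨ObjectProperty.isoMk _ e⟩⟩
      exists_iso_of_epi := fun {Y Z} p _ => by
        let q : (modInclusion K Γ).obj Y.obj ⟶ Z.obj := p.hom
        have hp : Epi q := (ModuleCat.epi_iff_surjective _).2 ((hull_epi_iff p).1 inferInstance)
        obtain ⟨X', ⟨e⟩⟩ := key fun r hr x => smul_eq_zero_of_epi q hr x
        have : Epi ((modInclusion K Γ).preimage (q ≫ e.inv)) := by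
          refine (modInclusion K Γ).epi_of_epi_map ?_
          rw [Functor.map_preimage]
          infer_instance
        exact ⟨⟨X', ObjectProperty.prop_of_epi _
          ((modInclusion K Γ).preimage (q ≫ e.inv)) Y.2⟩, ⟨ObjectProperty.isoMk _ e⟩⟩ }

end ColoredQuiver

namespace ColoredQuiver

open Quiver FormalMonoidAlgebra

variable {K : Type u} [Field K] {Γ : ColoredQuiver.{u}}

/-! ### Paths in the extended quiver -/

theorem mul_of_eq_mul_of_iff {α : Type*} {a b : FreeMonoid α} {x y : α} :
    a * FreeMonoid.of x = b * FreeMonoid.of y ↔ a = b ∧ x = y := by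
  refine ⟨fun h => ?_, fun ⟨h, h'⟩ => h ▸ h' ▸ rfl⟩
  have h' : a.toList ++ [x] = b.toList ++ [y] := h
  obtain ⟨h₁, h₂⟩ := List.append_inj' h' rfl
  exact ⟨h₁, by simpa using h₂⟩

/-- The vertex `(i, v)` of `Γ̃`. -/
abbrev vertexAt (i : ℕ) (v : Γ.Vertex) : Γ.tilde.Vertex := (i, v)

/-- The level `i` of the vertex `(i, v)` of `Γ̃`. -/
abbrev level (s : Γ.tilde.Vertex) : ℕ := Prod.fst (α := ℕ) (β := Γ.Vertex) s

/-- The new color `c_{v,w}`. -/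
abbrev newColor (v w : Γ.Vertex) : Γ.tilde.Color := Sum.inr (v, w)

/-- The new arrow `r^i_{v,w}`. -/
abbrev newArrow (i : ℕ) (v w : Γ.Vertex) : vertexAt i v ⟶ vertexAt (i + 1) w :=
  ⟨Sum.inr (i, v, w), rfl, rfl⟩

theorem level_le_of_path {s t : Γ.tilde.Vertex} (p : Path s t) : level s ≤ level t := by
  induction p with
  | nil => exact le_rfl
  | cons p r ih =>
    obtain ⟨⟨i, r⟩ | ⟨i, v, w⟩, rfl, rfl⟩ := r
    · exact ih
    · exact ih.trans (Nat.le_succ i)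

/-- A path whose last color is `c_{v,w}` ends with one of the arrows `r^i_{v,w}`. -/
theorem exists_eq_cons_of_pathColor {s t : Γ.tilde.Vertex} (p : Path s t)
    (c : FreeMonoid Γ.tilde.Color) (v w : Γ.Vertex)
    (h : pathColor p = c * FreeMonoid.of (newColor v w)) :
    ∃ (i : ℕ) (q : Path s (vertexAt i v)), pathColor q = c ∧
      (⟨t, p⟩ : Σ t, Path s t) = ⟨vertexAt (i + 1) w, q.cons (newArrow i v w)⟩ := by
  cases p with
  | nil =>
    have := congrArg FreeMonoid.length h
    simp [FreeMonoid.length_mul] at this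
  | cons p r =>
    rw [pathColor_cons] at h
    obtain ⟨hc, hr⟩ := mul_of_eq_mul_of_iff.1 h
    obtain ⟨⟨i, r⟩ | ⟨i, v', w'⟩, rfl, rfl⟩ := r
    · cases hr
    · obtain ⟨rfl, rfl⟩ : v' = v ∧ w' = w := by simpa [tilde, newColor] using hr
      exact ⟨i, p, hc, rfl⟩

/-- The word `c_{v,v}^n c_{v,w}`, where `x = (n, w)`. -/
def stepWord (v : Γ.Vertex) (x : ℕ × Γ.Vertex) : FreeMonoid Γ.tilde.Color :=
  FreeMonoid.of (newColor v v) ^ x.1 * FreeMonoid.of (newColor v x.2)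

theorem length_stepWord (v : Γ.Vertex) (x : ℕ × Γ.Vertex) : (stepWord v x).length = x.1 + 1 := by
  have (n : ℕ) (a : FreeMonoid Γ.tilde.Color) : (a ^ n).length = n * a.length := by
    induction n with
    | zero => simp
    | succ n ih => rw [pow_succ, FreeMonoid.length_mul, ih]; ring
  rw [stepWord, FreeMonoid.length_mul, this, FreeMonoid.length_of, FreeMonoid.length_of, mul_one]

theorem stepWord_injective (v : Γ.Vertex) : Function.Injective (stepWord v) := by
  rintro ⟨n, w⟩ ⟨m, x⟩ h
  obtain rfl : n = m := by simpa [length_stepWord] using congrArg FreeMonoid.length h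
  have h' : (Sum.inr (v, w) : Γ.Color ⊕ (Γ.Vertex × Γ.Vertex)) = Sum.inr (v, x) :=
    (mul_of_eq_mul_of_iff.1 h).2
  simpa using h'

theorem exists_path_pow (v : Γ.Vertex) (i n : ℕ) :
    ∃ p : Path (vertexAt i v) (vertexAt (i + n) v),
      pathColor p = FreeMonoid.of (newColor v v) ^ n := by
  induction n with
  | zero => exact ⟨Path.nil, rfl⟩
  | succ n ih =>
    obtain ⟨p, hp⟩ := ih
    refine ⟨p.cons (newArrow (i + n) v v), ?_⟩
    rw [pathColor_cons, hp, pow_succ]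
    rfl

theorem path_pow_source (v : Γ.Vertex) (n j : ℕ) {s : Γ.tilde.Vertex}
    (p : Path s (vertexAt j v)) (hp : pathColor p = FreeMonoid.of (newColor v v) ^ n) :
    ∃ i, i + n = j ∧ s = vertexAt i v := by
  induction n generalizing j with
  | zero =>
    have h : p.length = 0 := by rw [← length_pathColor, hp]; rfl
    exact ⟨j, rfl, p.eq_of_length_zero h⟩
  | succ n ih =>
    rw [pow_succ] at hp
    obtain ⟨i, q, hq, h⟩ := exists_eq_cons_of_pathColor p _ _ _ hp
    obtain rfl : j = i + 1 := congrArg (fun x : Σ t, Path s t => level x.1) h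
    obtain ⟨k, rfl, hs⟩ := ih i q hq
    exact ⟨k, rfl, hs⟩

theorem path_pow_unique (v : Γ.Vertex) (n : ℕ) {t s s' : Γ.tilde.Vertex} (p : Path s t)
    (p' : Path s' t) (hp : pathColor p = FreeMonoid.of (newColor v v) ^ n)
    (hp' : pathColor p' = FreeMonoid.of (newColor v v) ^ n) :
    (⟨s, p⟩ : Σ s, Path s t) = ⟨s', p'⟩ := by
  induction n generalizing t with
  | zero =>
    have h : p.length = 0 := by rw [← length_pathColor, hp]; rfl
    have h' : p'.length = 0 := by rw [← length_pathColor, hp']; rfl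
    obtain rfl := p.eq_of_length_zero h
    obtain rfl := p'.eq_of_length_zero h'
    rw [p.eq_nil_of_length_zero h, p'.eq_nil_of_length_zero h']
  | succ n ih =>
    rw [pow_succ] at hp hp'
    obtain ⟨i, q, hq, h⟩ := exists_eq_cons_of_pathColor p _ _ _ hp
    obtain ⟨i', q', hq', h'⟩ := exists_eq_cons_of_pathColor p' _ _ _ hp'
    obtain rfl : t = vertexAt (i + 1) v := congrArg Sigma.fst h
    obtain rfl : i = i' :=
      Nat.succ_injective (congrArg (fun x : Σ t, Path s' t => level x.1) h')
    obtain rfl := eq_of_heq (Sigma.mk.inj h).2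
    obtain rfl := eq_of_heq (Sigma.mk.inj h').2
    cases ih q q' hq hq'
    rfl

/-- The paths of color `c_{v,v}^n c_{v,w}` ending in `(j + 1, w)` correspond to the
decompositions `i + n = j`: for each of them there is exactly one such path, and it starts in
`(i, v)`. -/
theorem exists_stepPath (v w : Γ.Vertex) (j : ℕ) :
    ∃ g : ℕ × ℕ → Σ s, Path s (vertexAt (j + 1) w),
      (∀ x ∈ Finset.HasAntidiagonal.antidiagonal j, (g x).1 = vertexAt x.1 v ∧
        pathColor (g x).2 = stepWord v (x.2, w)) ∧
      ∀ r, ∀ x : ℕ × Γ.Vertex, pathColor r.2 = stepWord v x →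
        ∃ y ∈ Finset.HasAntidiagonal.antidiagonal j, r = g y := by
  have key : ∀ x : ℕ × ℕ, ∃ r : Σ s, Path s (vertexAt (j + 1) w),
      x ∈ Finset.HasAntidiagonal.antidiagonal j → ∃ q : Path (vertexAt x.1 v) (vertexAt j v),
        pathColor q = FreeMonoid.of (newColor v v) ^ x.2 ∧
        r = ⟨vertexAt x.1 v, q.cons (newArrow j v w)⟩ := by
    intro x
    by_cases hx : x ∈ Finset.HasAntidiagonal.antidiagonal j
    · obtain ⟨p, hp⟩ := exists_path_pow v x.1 x.2
      obtain rfl := Finset.HasAntidiagonal.mem_antidiagonal.1 hx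
      exact ⟨_, fun _ => ⟨p, hp, rfl⟩⟩
    · exact ⟨⟨_, Path.nil⟩, fun h => absurd h hx⟩
  choose g hg using key
  refine ⟨g, fun x hx => ?_, ?_⟩
  · obtain ⟨q, hq, h⟩ := hg x hx
    rw [h, pathColor_cons, hq]
    exact ⟨rfl, rfl⟩
  · rintro ⟨s, p⟩ ⟨n, w'⟩ h
    obtain ⟨i, q, hq, h'⟩ := exists_eq_cons_of_pathColor p _ _ _ h
    have ht : (j + 1, w) = (i + 1, w') := congrArg (fun x : Σ t, Path s t => x.1) h'
    obtain ⟨hij, rfl⟩ := Prod.mk.inj ht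
    obtain rfl : j = i := Nat.succ_injective hij
    obtain rfl := eq_of_heq (Sigma.mk.inj h').2
    obtain ⟨i, hi, rfl⟩ := path_pow_source v n j q hq
    refine ⟨(i, n), Finset.HasAntidiagonal.mem_antidiagonal.2 hi, ?_⟩
    obtain ⟨q', hq', h₁⟩ := hg (i, n) (Finset.HasAntidiagonal.mem_antidiagonal.2 hi)
    rw [h₁]
    cases path_pow_unique v n q q' hq hq'
    rfl

/-! ### Power series operators -/

/-- The formal sum `∑ λ_{n,w} c_{v,v}^n c_{v,w}` with coefficients `λ_{n,w}` given by the power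
series `Λ w = ∑ λ_{n,w} X^n`. -/
noncomputable def stepElement (v : Γ.Vertex) (Λ : Γ.Vertex → PowerSeries K) :
    FormalMonoidAlgebra K Γ.tilde.Color :=
  Function.extend (stepWord v) (fun x => PowerSeries.coeff x.1 (Λ x.2)) 0

theorem stepElement_stepWord (v : Γ.Vertex) (Λ : Γ.Vertex → PowerSeries K) (x : ℕ × Γ.Vertex) :
    stepElement v Λ (stepWord v x) = PowerSeries.coeff x.1 (Λ x.2) :=
  (stepWord_injective v).extend_apply _ _ _

theorem exists_stepWord_of_stepElement_ne_zero {v : Γ.Vertex} {Λ : Γ.Vertex → PowerSeries K}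
    {c : FreeMonoid Γ.tilde.Color} (h : stepElement v Λ c ≠ 0) : ∃ x, c = stepWord v x := by
  by_contra hc
  exact h (Function.extend_apply' _ _ _ fun ⟨x, hx⟩ => hc ⟨x, hx.symm⟩)

theorem level_ne_zero_of_stepElement_ne_zero {v : Γ.Vertex} {Λ : Γ.Vertex → PowerSeries K}
    {s t : Γ.tilde.Vertex} (p : Path s t) (h : stepElement v Λ (pathColor p) ≠ 0) :
    level t ≠ 0 := by
  obtain ⟨x, hx⟩ := exists_stepWord_of_stepElement_ne_zero h
  obtain ⟨i, q, -, h'⟩ := exists_eq_cons_of_pathColor p _ _ _ hx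
  have : level t = i + 1 := congrArg (fun x : Σ t, Path s t => level x.1) h'
  omega

theorem isAdmissible_stepElement (v : Γ.Vertex) (Λ : Γ.Vertex → PowerSeries K) :
    IsAdmissible (stepElement v Λ) := by
  rintro ⟨_ | j, w⟩
  · refine Set.finite_empty.subset fun r hr => ?_
    exact level_ne_zero_of_stepElement_ne_zero r.2 hr rfl
  · obtain ⟨g, -, hg⟩ := exists_stepPath v w j
    refine ((Finset.HasAntidiagonal.antidiagonal j).finite_toSet.image g).subset fun r hr => ?_
    obtain ⟨x, hx⟩ := exists_stepWord_of_stepElement_ne_zero hr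
    obtain ⟨y, hy, h⟩ := hg r x hx
    exact ⟨y, hy, h.symm⟩

/-- `stepElement` as a scalar of the right module `M_Γ̃`. -/
noncomputable def stepScalar (v : Γ.Vertex) (Λ : Γ.Vertex → PowerSeries K) :
    (admissibleAlgebra K Γ.tilde)ᵐᵒᵖ :=
  MulOpposite.op ⟨stepElement v Λ, isAdmissible_stepElement v Λ⟩

theorem stepScalar_smul_zero (v : Γ.Vertex) (Λ : Γ.Vertex → PowerSeries K)
    (y : FormalModule K Γ.tilde) (w : Γ.Vertex) : (stepScalar v Λ • y) (vertexAt 0 w) = 0 := by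
  rw [op_smul_apply]
  refine (finsum_congr fun r => ?_).trans finsum_zero
  by_contra h
  exact level_ne_zero_of_stepElement_ne_zero r.2 (left_ne_zero_of_mul h) rfl

/-- The action on the coefficients in level `j + 1` is multiplication of power series. -/
theorem stepScalar_smul_succ (v : Γ.Vertex) (Λ : Γ.Vertex → PowerSeries K)
    (y : FormalModule K Γ.tilde) (j : ℕ) (w : Γ.Vertex) :
    (stepScalar v Λ • y) (vertexAt (j + 1) w) =
      PowerSeries.coeff j (PowerSeries.mk (fun i => y (vertexAt i v)) * Λ w) := by
  classical
  obtain ⟨g, hg, hg'⟩ := exists_stepPath v w j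
  rw [op_smul_apply, PowerSeries.coeff_mul]
  rw [finsum_eq_sum_of_support_subset (s := (Finset.HasAntidiagonal.antidiagonal j).image g)]
  · rw [Finset.sum_image]
    · refine Finset.sum_congr rfl fun x hx => ?_
      obtain ⟨h₁, h₂⟩ := hg x hx
      rw [PowerSeries.coeff_mk, mul_comm, ← h₁]
      congr 1
      change stepElement v Λ (pathColor (g x).2) = _
      rw [h₂]
      exact stepElement_stepWord v Λ (x.2, w)
    · intro x hx y hy h
      have : vertexAt x.1 v = vertexAt y.1 v := by
        rw [← (hg x hx).1, h, (hg y hy).1]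
      exact Finset.HasAntidiagonal.antidiagonal_congr hx hy |>.2 (Prod.mk.inj this).1
  · intro r hr
    obtain ⟨x, hx⟩ := exists_stepWord_of_stepElement_ne_zero (left_ne_zero_of_mul hr)
    obtain ⟨y, hy, h⟩ := hg' r x hx
    rw [Finset.coe_image]
    exact ⟨y, hy, h.symm⟩

theorem projection_op_stepScalar (v : Γ.Vertex) (Λ : Γ.Vertex → PowerSeries K) :
    (projection K Γ).op (stepScalar v Λ) = 0 := by
  refine MulOpposite.unop_injective (Subtype.ext (FormalMonoidAlgebra.ext fun c => ?_))
  change stepElement v Λ (colorIncl c) = 0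
  by_contra h
  obtain ⟨x, hx⟩ := exists_stepWord_of_stepElement_ne_zero h
  obtain ⟨a, b, -, -, hb⟩ := colorIncl_eq_mul hx
  have hb' : List.map Sum.inl b.toList = [Sum.inr (v, x.2)] := hb
  obtain ⟨_, -, h⟩ := List.mem_map.1 (hb' ▸ List.mem_singleton_self (Sum.inr (v, x.2)))
  cases h

/-! ### Surjectivity of the projection -/

variable (Γ) in
/-- The inclusion of the copy `{i} × Γ` into `Γ̃`. -/
def inclLevel (i : ℕ) : Γ.Vertex ⥤q Γ.tilde.Vertex where
  obj v := vertexAt i v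
  map r := ⟨Sum.inl (i, r.1), by
    obtain ⟨r, rfl, rfl⟩ := r
    exact ⟨rfl, rfl⟩⟩

theorem pathColor_mapPath_inclLevel (i : ℕ) {v w : Γ.Vertex} (p : Path v w) :
    pathColor ((inclLevel Γ i).mapPath p) = colorIncl (pathColor p) := by
  induction p with
  | nil => rfl
  | cons p r ih =>
    rw [Prefunctor.mapPath_cons, pathColor_cons, pathColor_cons, map_mul, ih]
    rfl

/-- A path of `Γ̃` all of whose colors belong to `Γ` lies in a single copy of `Γ`. -/
theorem exists_mapPath_inclLevel {s t : Γ.tilde.Vertex} (p : Path s t)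
    {c : FreeMonoid Γ.Color} (h : pathColor p = colorIncl c) (i : ℕ) (w : Γ.Vertex)
    (ht : t = vertexAt i w) : ∃ (v : Γ.Vertex) (q : Path v w),
      (⟨s, ht ▸ p⟩ : Σ s, Path s (vertexAt i w)) = ⟨vertexAt i v, (inclLevel Γ i).mapPath q⟩ := by
  induction p generalizing w c with
  | nil =>
    subst ht
    exact ⟨w, Path.nil, rfl⟩
  | cons p r ih =>
    subst ht
    obtain ⟨a, b, -, ha, hb⟩ := colorIncl_eq_mul (h.symm.trans (pathColor_cons p r))
    obtain ⟨⟨j, r⟩ | ⟨j, v', w'⟩, hr, hr'⟩ := r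
    · obtain ⟨rfl, rfl⟩ : j = i ∧ Γ.tgt r = w := Prod.ext_iff.1 hr'
      subst hr
      obtain ⟨v, q, hq⟩ := ih ha.symm (Γ.src r) rfl
      refine ⟨v, q.cons ⟨r, rfl, rfl⟩, ?_⟩
      cases hq
      rfl
    · have hb' : List.map Sum.inl b.toList = [Sum.inr (v', w')] := hb
      obtain ⟨_, -, h⟩ := List.mem_map.1 (hb' ▸ List.mem_singleton_self (Sum.inr (v', w')))
      cases h

theorem projection_surjective : Function.Surjective (projection K Γ) := by
  rintro ⟨f, hf⟩
  have hext (c : FreeMonoid Γ.Color) : Function.extend colorIncl f 0 (colorIncl c) = f c :=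
    colorIncl_injective.extend_apply _ _ _
  refine ⟨⟨(Function.extend colorIncl f 0 : FreeMonoid Γ.tilde.Color → K), ?_⟩,
    Subtype.ext (FormalMonoidAlgebra.ext hext)⟩
  rintro ⟨i, w⟩
  refine ((hf w).image fun q => (⟨vertexAt i q.1, (inclLevel Γ i).mapPath q.2⟩ :
    Σ s, Path s (vertexAt i w))).subset ?_
  rintro ⟨s, p⟩ hp
  replace hp : Function.extend colorIncl f 0 (pathColor p) ≠ 0 := hp
  obtain ⟨c, hc⟩ : ∃ c, colorIncl c = pathColor p := by
    by_contra h
    exact hp (Function.extend_apply' _ _ _ h)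
  obtain ⟨v, q, hq⟩ := exists_mapPath_inclLevel p hc.symm i w rfl
  cases hq
  exact ⟨⟨v, q⟩, fun h0 => hp ((congrArg (Function.extend colorIncl f 0)
    (pathColor_mapPath_inclLevel i q)).trans ((hext _).trans h0)), rfl⟩

theorem projection_op_surjective : Function.Surjective (projection K Γ).op := by
  intro f
  obtain ⟨g, hg⟩ := projection_surjective f.unop
  exact ⟨MulOpposite.op g, MulOpposite.unop_injective hg⟩

/-! ### The shift endomorphism -/

variable (Γ) in
/-- The endomorphism of `Γ̃` that raises the level by one. -/
def raise : Γ.tilde.Vertex ⥤q Γ.tilde.Vertex where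
  obj s := vertexAt (level s + 1) (Prod.snd (α := ℕ) (β := Γ.Vertex) s)
  map r := ⟨Sum.map (Prod.map Nat.succ id) (Prod.map Nat.succ id)
      (show (ℕ × Γ.Arrow) ⊕ (ℕ × Γ.Vertex × Γ.Vertex) from r.1), by
    obtain ⟨⟨i, r⟩ | ⟨i, v, w⟩, rfl, rfl⟩ := r
    · exact ⟨rfl, rfl⟩
    · exact ⟨rfl, rfl⟩⟩

theorem pathColor_mapPath_raise {s t : Γ.tilde.Vertex} (p : Path s t) :
    pathColor ((raise Γ).mapPath p) = pathColor p := by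
  induction p with
  | nil => rfl
  | cons p r ih =>
    rw [Prefunctor.mapPath_cons, pathColor_cons, pathColor_cons, ih]
    obtain ⟨⟨i, r⟩ | ⟨i, v, w⟩, rfl, rfl⟩ := r
    · rfl
    · rfl

/-- The map on paths with a given target induced by `raise`. -/
def raisePath (t : Γ.tilde.Vertex) (p : Σ s : Γ.tilde.Vertex, Path s t) :
    Σ s : Γ.tilde.Vertex, Path s ((raise Γ).obj t) :=
  ⟨(raise Γ).obj p.1, (raise Γ).mapPath p.2⟩

theorem raise_obj_injective : Function.Injective (raise Γ).obj := by
  rintro ⟨i, v⟩ ⟨j, w⟩ h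
  obtain ⟨h₁, h₂⟩ := Prod.mk.inj h
  obtain rfl : i = j := Nat.succ_injective h₁
  obtain rfl : v = w := h₂
  rfl

theorem raise_map_injective {s t : Γ.tilde.Vertex} {r r' : s ⟶ t}
    (h : (raise Γ).map r = (raise Γ).map r') : r = r' := by
  have hs {α : Type u} : Function.Injective (Prod.map Nat.succ (id : α → α)) :=
    Nat.succ_injective.prodMap Function.injective_id
  exact Subtype.ext (Function.Injective.sumMap hs hs (congrArg Subtype.val h))

theorem raisePath_injective (t : Γ.tilde.Vertex) : Function.Injective (raisePath t) := by
  rintro ⟨s, p⟩ ⟨s', p'⟩ h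
  obtain rfl : s = s' := raise_obj_injective (congrArg Sigma.fst h)
  replace h : (raise Γ).mapPath p = (raise Γ).mapPath p' := by
    simpa [raisePath] using h
  congr 1
  induction p with
  | nil =>
    cases p' with
    | nil => rfl
    | cons p' r' => simp at h
  | cons p r ih =>
    cases p' with
    | nil => simp at h
    | cons p' r' =>
      simp only [Prefunctor.mapPath_cons, Path.cons.injEq] at h
      obtain ⟨h₀, h₁, h₂⟩ := h
      obtain rfl := raise_obj_injective h₀
      obtain rfl := ih _ (eq_of_heq h₁)
      obtain rfl := raise_map_injective (eq_of_heq h₂)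
      rfl

/-- A path that starts in positive level is in the image of `raise`. -/
theorem exists_raisePath {s t : Γ.tilde.Vertex} (p : Path s t) (hs : level s ≠ 0)
    (t' : Γ.tilde.Vertex) (ht : t = (raise Γ).obj t') :
    ∃ q, raisePath t' q = ⟨s, ht ▸ p⟩ := by
  induction p generalizing t' with
  | nil =>
    subst ht
    exact ⟨⟨t', Path.nil⟩, rfl⟩
  | cons p r ih =>
    subst ht
    obtain ⟨i', w'⟩ := t'
    obtain ⟨⟨i, r⟩ | ⟨i, v, w⟩, hr, hr'⟩ := r
    · obtain ⟨hi, rfl⟩ : i = i' + 1 ∧ Γ.tgt r = w' := Prod.ext_iff.1 hr'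
      subst hi
      subst hr
      obtain ⟨⟨x, q⟩, hq⟩ := ih (vertexAt i' (Γ.src r)) rfl
      refine ⟨⟨x, q.cons ⟨Sum.inl (i', r), rfl, rfl⟩⟩, ?_⟩
      cases hq
      rfl
    · obtain ⟨hi, rfl⟩ : i + 1 = i' + 1 ∧ w = w' := Prod.ext_iff.1 hr'
      obtain rfl := Nat.succ_injective hi
      subst hr
      obtain ⟨j, rfl⟩ : ∃ j, i = j + 1 :=
        Nat.exists_eq_succ_of_ne_zero fun h => hs (Nat.le_zero.1 (h ▸ level_le_of_path p))
      obtain ⟨⟨x, q⟩, hq⟩ := ih (vertexAt j v) rfl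
      refine ⟨⟨x, q.cons ⟨Sum.inr (j, v, w), rfl, rfl⟩⟩, ?_⟩
      cases hq
      rfl

variable (K Γ) in
/-- The endomorphism of `M_Γ̃` that sends `x_{(i,v)}` to `x_{(i+1,v)}`. -/
noncomputable def shift :
    FormalModule K Γ.tilde →ₗ[(admissibleAlgebra K Γ.tilde)ᵐᵒᵖ] FormalModule K Γ.tilde where
  toFun y := fun s : ℕ × Γ.Vertex => Nat.casesOn s.1 0 fun i => y (vertexAt i s.2)
  map_add' y z := by
    refine FormalModule.ext (K := K) (Γ := Γ.tilde) fun s => ?_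
    obtain ⟨_ | i, v⟩ := s
    · exact (add_zero (0 : K)).symm
    · rfl
  map_smul' f y := by
    refine FormalModule.ext (K := K) (Γ := Γ.tilde) fun s => ?_
    obtain ⟨_ | i, v⟩ := s
    · refine (finsum_congr fun r => ?_).trans finsum_zero |>.symm
      obtain ⟨⟨j, x⟩, p⟩ := r
      obtain rfl : j = 0 := Nat.le_zero.1 (level_le_of_path p)
      exact mul_zero _
    · let Y : FormalModule K Γ.tilde :=
        fun s : ℕ × Γ.Vertex => Nat.casesOn s.1 0 fun i => y (vertexAt i s.2)
      let F : (Σ s, Path s (vertexAt (i + 1) v)) → K := fun r => f.unop.1 (pathColor r.2) * Y r.1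
      have hF : (Set.range (raisePath (vertexAt i v))).indicator F = F := by
        refine Set.indicator_eq_self.2 fun r hr => ?_
        have : level r.1 ≠ 0 := by
          intro h0
          refine hr ?_
          obtain ⟨⟨j, x⟩, p⟩ := r
          obtain rfl : j = 0 := h0
          exact mul_zero _
        exact exists_raisePath r.2 this (vertexAt i v) rfl
      have hsum : ∑ᶠ r, F r = ∑ᶠ q, F (raisePath (vertexAt i v) q) :=
        calc
          ∑ᶠ r, F r = ∑ᶠ r, (Set.range (raisePath (vertexAt i v))).indicator F r :=
            congrArg finsum hF.symm
          _ = ∑ᶠ r ∈ Set.range (raisePath (vertexAt i v)), F r := (finsum_mem_def _ _).symm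
          _ = _ := finsum_mem_range (raisePath_injective _)
      refine (finsum_congr fun q => ?_).trans hsum.symm
      exact congrArg (fun c => f.unop.1 c * y q.1) (pathColor_mapPath_raise q.2).symm

/-! ### Submodules of the module of the extended quiver -/

theorem shift_injective : Function.Injective (shift K Γ) := fun _ _ h =>
  FormalModule.ext fun ⟨i, v⟩ =>
    congrArg (fun f : FormalModule K Γ.tilde => f (vertexAt (i + 1) v)) h

/-- The image of the `n`-th power of the shift consists of the elements supported in the levels
`≥ n`. -/
theorem mem_range_shift_pow {n : ℕ} {y : FormalModule K Γ.tilde} :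
    y ∈ (shift K Γ ^ n).range ↔ ∀ i < n, ∀ v, y (vertexAt i v) = 0 := by
  induction n generalizing y with
  | zero => exact ⟨fun _ i hi => absurd hi (Nat.not_lt_zero i), fun _ => ⟨y, rfl⟩⟩
  | succ n ih =>
    constructor
    · rintro ⟨z, rfl⟩ i hi v
      rw [pow_succ']
      cases i with
      | zero => rfl
      | succ i => exact ih.1 ⟨z, rfl⟩ i (Nat.lt_of_succ_lt_succ hi) v
    · intro h
      obtain ⟨z, hz⟩ := (ih (y := fun s : ℕ × Γ.Vertex => y (vertexAt (s.1 + 1) s.2))).2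
        fun i hi v => h (i + 1) (Nat.succ_lt_succ hi) v
      refine ⟨z, ?_⟩
      rw [pow_succ', Module.End.mul_apply, hz]
      refine FormalModule.ext (K := K) (Γ := Γ.tilde) fun s => ?_
      obtain ⟨_ | i, v⟩ := s
      · exact (h 0 n.succ_pos v).symm
      · rfl

theorem moduleProjection_eq_zero_iff {y : FormalModule K Γ.tilde} :
    moduleProjection K Γ y = 0 ↔ y ∈ (shift K Γ).range := by
  rw [← pow_one (shift K Γ), mem_range_shift_pow]
  constructor
  · intro h i hi v
    obtain rfl : i = 0 := by omega
    exact congrArg (fun f : FormalModule K Γ => f v) h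
  · intro h
    exact FormalModule.ext (K := K) (Γ := Γ) fun v => h 0 one_pos v

/-- The kernel of `F_Γ̃ → F_Γ` maps `M_Γ̃` into the image of the shift, as it annihilates the
quotient `M_Γ`. -/
theorem smul_mem_range_shift {f : (admissibleAlgebra K Γ.tilde)ᵐᵒᵖ}
    (hf : (projection K Γ).op f = 0) (y : FormalModule K Γ.tilde) :
    f • y ∈ (shift K Γ).range := by
  rw [← moduleProjection_eq_zero_iff]
  refine ((moduleProjection K Γ).hom.map_smul f y).trans ?_
  change (projection K Γ).op f • (show FormalModule K Γ from moduleProjection K Γ y) = 0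
  rw [hf, zero_smul]

theorem pow_smul_mem_range_shift_pow {f : (admissibleAlgebra K Γ.tilde)ᵐᵒᵖ}
    (hf : (projection K Γ).op f = 0) (n : ℕ) (y : FormalModule K Γ.tilde) :
    f ^ n • y ∈ (shift K Γ ^ n).range := by
  induction n with
  | zero => exact ⟨y, one_smul _ y |>.symm⟩
  | succ n ih =>
    obtain ⟨z, hz⟩ := ih
    obtain ⟨z', hz'⟩ := smul_mem_range_shift hf z
    refine ⟨z', ?_⟩
    rw [pow_succ' f, mul_smul, ← hz, ← map_smul, ← hz', pow_succ, Module.End.mul_apply]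

/-- Each nonzero submodule contains all elements supported in sufficiently high levels. If the
lowest level in which `y` does not vanish is `i`, say `y (i, v) ≠ 0`, then the power series of the
coefficients of `y` at the vertices `(i + k, v)` is invertible, and thus each element supported in
the levels `≥ i + 1` is obtained from `y` by applying a formal sum of the words
`c_{v,v}^n c_{v,w}`. -/
theorem exists_range_shift_pow_le_span {y : FormalModule K Γ.tilde} (hy : y ≠ 0) :
    ∃ n, (shift K Γ ^ n).range ≤ Submodule.span (admissibleAlgebra K Γ.tilde)ᵐᵒᵖ {y} := by
  classical
  -- `i` is the lowest level in which `y` does not vanish.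
  have hex : ∃ i v, y (vertexAt i v) ≠ 0 := by
    by_contra! h
    exact hy (FormalModule.ext fun ⟨i, v⟩ => h i v)
  obtain ⟨i, ⟨v, hv⟩, hmin⟩ : ∃ i, (∃ v, y (vertexAt i v) ≠ 0) ∧
      ∀ k < i, ∀ v, y (vertexAt k v) = 0 :=
    ⟨Nat.find hex, Nat.find_spec hex, fun k hk v => by
      by_contra h
      exact Nat.find_min hex hk ⟨v, h⟩⟩
  refine ⟨i + 1, fun z hz => Submodule.mem_span_singleton.2 ?_⟩
  rw [mem_range_shift_pow] at hz
  let Y : PowerSeries K := PowerSeries.mk fun k => y (vertexAt (i + k) v)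
  let Z : Γ.Vertex → PowerSeries K := fun w => PowerSeries.mk fun k => z (vertexAt (i + 1 + k) w)
  have hY : PowerSeries.constantCoeff Y ≠ 0 := by
    rw [← PowerSeries.coeff_zero_eq_constantCoeff_apply, PowerSeries.coeff_mk]
    exact hv
  have hy' : (PowerSeries.mk fun k => y (vertexAt k v)) = PowerSeries.X ^ i * Y := by
    ext k
    rw [PowerSeries.coeff_X_pow_mul', PowerSeries.coeff_mk]
    split_ifs with hk
    · rw [PowerSeries.coeff_mk, Nat.add_sub_cancel' hk]
    · exact hmin k (not_le.1 hk) v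
  refine ⟨stepScalar v fun w => Y⁻¹ * Z w, FormalModule.ext (K := K) (Γ := Γ.tilde) fun s => ?_⟩
  obtain ⟨_ | j, w⟩ := s
  · exact (stepScalar_smul_zero v _ y w).trans (hz 0 i.succ_pos w).symm
  · refine (stepScalar_smul_succ v _ y j w).trans ?_
    rw [hy', mul_assoc, ← mul_assoc Y, PowerSeries.mul_inv_cancel Y hY, one_mul,
      PowerSeries.coeff_X_pow_mul']
    split_ifs with hj
    · rw [PowerSeries.coeff_mk]
      congr 2
      omega
    · exact (hz (j + 1) (by omega) w).symm

theorem exists_range_shift_pow_le {N : Submodule (admissibleAlgebra K Γ.tilde)ᵐᵒᵖ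
    (FormalModule K Γ.tilde)} (hN : N ≠ ⊥) : ∃ n, (shift K Γ ^ n).range ≤ N := by
  obtain ⟨y, hy, hy0⟩ := N.ne_bot_iff.1 hN
  obtain ⟨n, hn⟩ := exists_range_shift_pow_le_span hy0
  exact ⟨n, hn.trans (by rwa [Submodule.span_singleton_le_iff_mem])⟩

/-- The scalar `∑ c_{v,w}`, the sum over all `w`. -/
noncomputable abbrev liftScalar (K : Type u) [Field K] {Γ : ColoredQuiver.{u}} (v : Γ.Vertex) :
    (admissibleAlgebra K Γ.tilde)ᵐᵒᵖ :=
  stepScalar v fun _ => 1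

theorem liftScalar_pow_smul (v : Γ.Vertex) (y : FormalModule K Γ.tilde) (n j : ℕ) :
    (liftScalar K v ^ n • y) (vertexAt (j + n) v) = y (vertexAt j v) := by
  induction n with
  | zero => rw [pow_zero, one_smul]; rfl
  | succ n ih =>
    rw [pow_succ', mul_smul]
    refine (stepScalar_smul_succ v _ _ (j + n) v).trans ?_
    rw [mul_one, PowerSeries.coeff_mk, ih]

/-- Powers of `∑ c_{v,w}` do not annihilate any nonzero submodule. -/
theorem exists_liftScalar_pow_smul_ne_zero (v : Γ.Vertex) {N : Submodule
    (admissibleAlgebra K Γ.tilde)ᵐᵒᵖ (FormalModule K Γ.tilde)} (hN : N ≠ ⊥) :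
    ∃ y ∈ N, ∀ m, liftScalar K v ^ m • y ≠ 0 := by
  obtain ⟨n, hn⟩ := exists_range_shift_pow_le hN
  let y : FormalModule K Γ.tilde := fun s : ℕ × Γ.Vertex => if s.1 < n then 0 else 1
  refine ⟨y, hn (mem_range_shift_pow.2 fun i hi v => if_pos hi), fun m h => ?_⟩
  have h1 := liftScalar_pow_smul v y m n
  rw [h] at h1
  have h2 : y (vertexAt n v) = 1 := if_neg (lt_irrefl n)
  exact zero_ne_one (h1.trans h2)

theorem isNoetherian_formalModule_tilde [IsNoetherian (admissibleAlgebra K Γ)ᵐᵒᵖ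
    (formalModule K Γ)] :
    IsNoetherian (admissibleAlgebra K Γ.tilde)ᵐᵒᵖ (FormalModule K Γ.tilde) := by
  have := isNoetherian_restrictScalars (projection_op_surjective (K := K) (Γ := Γ))
    (formalModule K Γ)
  -- The quotients by the images of the powers of the shift are noetherian by induction.
  have hquot (n : ℕ) : IsNoetherian (admissibleAlgebra K Γ.tilde)ᵐᵒᵖ
      (FormalModule K Γ.tilde ⧸ (shift K Γ ^ n).range) := by
    induction n with
    | zero =>
      have : Subsingleton (FormalModule K Γ.tilde ⧸ (shift K Γ ^ 0).range) := by
        rw [Submodule.Quotient.subsingleton_iff, pow_zero]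
        exact LinearMap.range_id
      infer_instance
    | succ n ih =>
      have hle : (shift K Γ ^ n).range ≤ ((shift K Γ ^ (n + 1)).range).comap (shift K Γ) := by
        rintro _ ⟨z, rfl⟩
        exact ⟨z, by rw [pow_succ']; rfl⟩
      have hle' : (shift K Γ ^ (n + 1)).range ≤ (moduleProjection K Γ).hom.ker := by
        rintro _ ⟨z, rfl⟩
        exact moduleProjection_eq_zero_iff.2 ⟨(shift K Γ ^ n) z, by rw [pow_succ']; rfl⟩
      refine isNoetherian_of_range_eq_ker (Submodule.mapQ _ _ (shift K Γ) hle)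
        (Submodule.liftQ _ (moduleProjection K Γ).hom hle') ?_
      ext q
      obtain ⟨y, rfl⟩ := Submodule.mkQ_surjective _ q
      constructor
      · rintro ⟨p, hp⟩
        obtain ⟨z, rfl⟩ := Submodule.mkQ_surjective _ p
        rw [← hp]
        exact moduleProjection_eq_zero_iff.2 ⟨z, rfl⟩
      · intro h
        obtain ⟨z, rfl⟩ := moduleProjection_eq_zero_iff.1 h
        exact ⟨Submodule.mkQ _ z, rfl⟩
  -- A nonzero submodule `N` contains a cyclic submodule whose quotient is noetherian.
  refine ⟨fun N => ?_⟩
  by_cases hN : N = ⊥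
  · rw [hN]
    exact Submodule.fg_bot
  obtain ⟨y, hy, hy0⟩ := N.ne_bot_iff.1 hN
  obtain ⟨n, hn⟩ := exists_range_shift_pow_le_span hy0
  have := hquot n
  have : IsNoetherian (admissibleAlgebra K Γ.tilde)ᵐᵒᵖ
      (FormalModule K Γ.tilde ⧸ Submodule.span (admissibleAlgebra K Γ.tilde)ᵐᵒᵖ {y}) :=
    isNoetherian_of_surjective (Submodule.factor hn) (LinearMap.range_eq_top.2
      (Submodule.factor_surjective hn))
  refine Submodule.fg_of_fg_map_of_fg_inf_ker (Submodule.mkQ (Submodule.span _ {y}))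
    (IsNoetherian.noetherian _) ?_
  rw [Submodule.ker_mkQ, inf_eq_right.2 (by rwa [Submodule.span_singleton_le_iff_mem])]
  exact Submodule.fg_span_singleton y

end ColoredQuiver

/-! ### Atom supports in a weakly closed hull -/

section Hull

variable {R : Type u} [Ring R] {M : ModuleCat.{u} R}

/-- The object `M` of its weakly closed hull. -/
def hullSelf (M : ModuleCat.{u} R) : (weaklyClosedHull.{u} M).FullSubcategory :=
  ⟨M, weaklyClosedHull_self M⟩

theorem hullSubmodule_not_isZero {X : (weaklyClosedHull.{u} M).FullSubcategory}
    {N : Submodule R X.obj} {x : X.obj} (hx : x ∈ N) (h : x ≠ 0) : ¬ IsZero (hullSubmodule N) :=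
  fun h0 => h (congrArg Subtype.val ((hull_isZero_iff _).1 h0 ⟨x, hx⟩))

theorem exists_ne_zero_of_not_isZero {X : (weaklyClosedHull.{u} M).FullSubcategory}
    (h : ¬ IsZero X) : ∃ x : X.obj, x ≠ 0 := by
  rw [hull_isZero_iff] at h
  push Not at h
  exact h

/-- Every nonzero object of the weakly closed hull of `M` contains an element `y ≠ 0` whose
annihilator is the annihilator of an element of a quotient of `M`. -/
theorem exists_annihilator_of_not_isZero {X : (weaklyClosedHull.{u} M).FullSubcategory}
    (h : ¬ IsZero X) : ∃ y : X.obj, y ≠ 0 ∧ ∃ (B : Submodule R M) (m : M),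
      ∀ s : R, s • y = 0 ↔ s • m ∈ B := by
  obtain ⟨x, hx⟩ := exists_ne_zero_of_not_isZero h
  obtain ⟨r, hr, B, m, h⟩ := hasCyclicSubquotients_of_weaklyClosedHull X.2 ⊥ x hx
  exact ⟨r • x, hr, B, m, h⟩

/-- If the annihilator of `p` is contained in that of `q`, then the module generated by `q` is a
quotient of the module generated by `p`; if the annihilators agree, the two are isomorphic. -/
theorem exists_epi_hullSubmodule {X Y : (weaklyClosedHull.{u} M).FullSubcategory} {p : X.obj}
    {q : Y.obj} (h : ∀ r : R, r • p = 0 → r • q = 0) :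
    ∃ f : hullSubmodule (Submodule.span R {p}) ⟶ hullSubmodule (Submodule.span R {q}),
      Epi f ∧ ((∀ r : R, r • q = 0 → r • p = 0) → Mono f) := by
  obtain ⟨f, hf⟩ := exists_linearMap_span_singleton h
  have hmem : ∀ x, f x ∈ Submodule.span R {q} := by
    rintro ⟨x, hx⟩
    obtain ⟨r, rfl⟩ := Submodule.mem_span_singleton.1 hx
    rw [hf]
    exact Submodule.smul_mem _ r (Submodule.mem_span_singleton_self q)
  refine ⟨ObjectProperty.homMk (ModuleCat.ofHom (f.codRestrict _ hmem)), (hull_epi_iff _).2 ?_,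
    fun h' => (hull_mono_iff _).2 ((injective_iff_map_eq_zero (f.codRestrict _ hmem)).2 ?_)⟩
  · rintro ⟨y, hy⟩
    obtain ⟨r, rfl⟩ := Submodule.mem_span_singleton.1 hy
    exact ⟨⟨r • p, Submodule.smul_mem _ r (Submodule.mem_span_singleton_self p)⟩,
      Subtype.ext (hf r)⟩
  · rintro ⟨x, hx⟩ h0
    obtain ⟨r, rfl⟩ := Submodule.mem_span_singleton.1 hx
    exact Subtype.ext (h' r ((hf r).symm.trans (congrArg Subtype.val h0)))

/-- Every atom of the weakly closed hull of `M` lies in the atom support of `M`. -/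
theorem atom_mem_ASupp_hullSelf {H : (weaklyClosedHull.{u} M).FullSubcategory}
    (h : IsMonoform H) : atom H h ∈ ASupp (hullSelf M) := by
  obtain ⟨y, hy, B, m, hB⟩ := exists_annihilator_of_not_isZero h.1
  obtain ⟨f, _, -⟩ := exists_epi_hullSubmodule (X := hullSelf M) (p := m) (q := y)
    fun r hr => (hB r).2 (hr ▸ B.zero_mem)
  exact (atom_mem_ASupp_iff h).2 ⟨_, hullSubtype (Submodule.span R {y}), inferInstance,
    hullSubmodule_not_isZero (Submodule.mem_span_singleton_self y) hy,
    isSubquotient_iff.2 ⟨_, hullSubtype (X := hullSelf M) (Submodule.span R {m}), f,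
      inferInstance, inferInstance⟩⟩

theorem range_ne_bot {X Y : (weaklyClosedHull.{u} M).FullSubcategory} (i : X ⟶ Y) [Mono i]
    (h : ¬ IsZero X) : i.hom.hom.range ≠ ⊥ := by
  obtain ⟨x, hx⟩ := exists_ne_zero_of_not_isZero h
  intro h0
  refine hx ((hull_mono_iff i).1 inferInstance ((?_ : i.hom.hom x = 0).trans (map_zero _).symm))
  exact (Submodule.mem_bot R).1 (h0 ▸ ⟨x, rfl⟩)

end Hull

namespace ColoredQuiver

variable {K : Type u} [Field K] {Γ : ColoredQuiver.{u}}

/-! ### The category of the extended quiver -/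

theorem isNoetherianObject_grothendieckModule_tilde
    (h : IsNoetherianObject (grothendieckModule K Γ)) :
    IsNoetherianObject (grothendieckModule K Γ.tilde) ∧
      IsLocallyNoetherianGrothendieck.{u} (Grothendieck K Γ.tilde) := by
  have : IsNoetherian (admissibleAlgebra K Γ)ᵐᵒᵖ (formalModule K Γ) :=
    (isNoetherianObject_iff_isNoetherian _).1 h
  have h' : IsNoetherian (admissibleAlgebra K Γ.tilde)ᵐᵒᵖ (formalModule K Γ.tilde) :=
    isNoetherian_formalModule_tilde
  exact ⟨(isNoetherianObject_iff_isNoetherian _).2 h', isLocallyNoetherianGrothendieck_hull⟩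

variable (K Γ) in
/-- The powers of the shift, as endomorphisms of `M_Γ̃` in `G_Γ̃`. -/
noncomputable abbrev shiftPowHom (n : ℕ) :
    grothendieckModule K Γ.tilde ⟶ grothendieckModule K Γ.tilde :=
  ObjectProperty.homMk (ModuleCat.ofHom (X := FormalModule K Γ.tilde)
    (Y := FormalModule K Γ.tilde) (shift K Γ ^ n))

instance (n : ℕ) : Mono (shiftPowHom K Γ n) := by
  refine (hull_mono_iff _).2 ?_
  change Function.Injective ⇑(shift K Γ ^ n)
  rw [Module.End.coe_pow]
  exact shift_injective.iterate n

theorem not_isZero_grothendieckModule (hΓ : Nonempty Γ.Vertex) :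
    ¬ IsZero (grothendieckModule K Γ.tilde) := by
  obtain ⟨v⟩ := hΓ
  intro h
  have := (hull_isZero_iff _).1 h (fun _ => 1 : FormalModule K Γ.tilde)
  exact one_ne_zero (congrArg (fun f : FormalModule K Γ.tilde => f (vertexAt 0 v)) this)

/-- Each nonzero subobject of `M_Γ̃` contains the image of a power of the shift, hence a copy of
`M_Γ̃`. -/
theorem exists_mono_of_mono {L : Grothendieck K Γ.tilde} (i : L ⟶ grothendieckModule K Γ.tilde)
    [Mono i] (hL : ¬ IsZero L) : ∃ j : grothendieckModule K Γ.tilde ⟶ L, Mono j := by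
  obtain ⟨n, hn⟩ := exists_range_shift_pow_le (range_ne_bot i hL)
  obtain ⟨k, hk⟩ := exists_factorization_of_range_le (shiftPowHom K Γ n) i hn
  exact ⟨k, mono_of_mono_fac hk⟩

theorem isCompressible_grothendieckModule_tilde (hΓ : Nonempty Γ.Vertex) :
    IsCompressible (grothendieckModule K Γ.tilde) :=
  isCompressible_iff.2 ⟨not_isZero_grothendieckModule hΓ, fun _ i _ hL => exists_mono_of_mono i hL⟩

/-- A proper quotient of `M_Γ̃` is annihilated by a power of `∑ c_{v,w}`, whereas no nonzero
subobject of `M_Γ̃` is. -/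
theorem isMonoform_grothendieckModule_tilde (hΓ : Nonempty Γ.Vertex) :
    IsMonoform (grothendieckModule K Γ.tilde) := by
  refine isMonoform_iff.2 ⟨not_isZero_grothendieckModule hΓ, fun Q X q i j _ _ _ hX => ?_⟩
  obtain ⟨v⟩ := hΓ
  by_contra hq
  have hker : q.hom.hom.ker ≠ ⊥ := by
    rw [Ne, LinearMap.ker_eq_bot]
    exact fun h => hq ((hull_mono_iff q).2 h)
  obtain ⟨m, hm⟩ := exists_range_shift_pow_le hker
  obtain ⟨_, ⟨x, rfl⟩, hx⟩ := exists_liftScalar_pow_smul_ne_zero v (range_ne_bot i hX)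
  refine hx m ?_
  refine (i.hom.hom.map_smul _ x).symm.trans ((congrArg i.hom.hom ?_).trans (map_zero i.hom.hom))
  apply (hull_mono_iff j).1 inferInstance
  rw [map_smul, map_zero]
  obtain ⟨y, hy⟩ := (hull_epi_iff q).1 inferInstance (j.hom.hom x)
  rw [← hy, ← map_smul]
  exact hm (pow_smul_mem_range_shift_pow (projection_op_stepScalar v _) m y)

instance : IsSubquotientClosedEmbedding (inclusion K Γ) :=
  isSubquotientClosedEmbedding_inclusion projection_op_surjective

open IsSubquotientClosedEmbedding

/-- Each nonzero object of `G_Γ̃` contains a copy of `M_Γ̃` or a nonzero object of `G_Γ`. -/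
theorem exists_mono_grothendieckModule_or_inclusion {X : Grothendieck K Γ.tilde}
    (hX : ¬ IsZero X) : (∃ k : grothendieckModule K Γ.tilde ⟶ X, Mono k) ∨
      ∃ (Y : Grothendieck K Γ) (k : (inclusion K Γ).obj Y ⟶ X), ¬ IsZero Y ∧ Mono k := by
  obtain ⟨y, hy, B, m, hB⟩ := exists_annihilator_of_not_isZero hX
  by_cases hB0 : B = ⊥
  · left
    have hm : m ≠ 0 := fun h0 => hy (by
      rw [← one_smul (admissibleAlgebra K Γ.tilde)ᵐᵒᵖ y, hB, h0, smul_zero]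
      exact B.zero_mem)
    have hB' (s : (admissibleAlgebra K Γ.tilde)ᵐᵒᵖ) : s • y = 0 ↔ s • m = 0 := by
      rw [hB, hB0, Submodule.mem_bot]
    obtain ⟨f, -, hf⟩ := exists_epi_hullSubmodule (X := grothendieckModule K Γ.tilde) (Y := X)
      fun s => (hB' s).2
    have := hf fun s => (hB' s).1
    obtain ⟨j, _⟩ := exists_mono_of_mono
      (hullSubtype (X := grothendieckModule K Γ.tilde) (Submodule.span _ {m}))
      (hullSubmodule_not_isZero (Submodule.mem_span_singleton_self m) hm)
    exact ⟨j ≫ f ≫ hullSubtype _, inferInstance⟩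
  · right
    obtain ⟨n, hn⟩ := exists_range_shift_pow_le hB0
    -- Take `k` maximal such that some multiple of `m` in the image of the `k`-th power of the
    -- shift does not lie in `B`.
    let P : ℕ → Prop := fun i => ∀ r : (admissibleAlgebra K Γ.tilde)ᵐᵒᵖ,
      r • m ∈ (shift K Γ ^ i).range → r • m ∈ B
    have hP : ∃ i, P i := ⟨n, fun r hr => hn hr⟩
    obtain ⟨k, hk, hk'⟩ : ∃ k, ¬ P k ∧ P (k + 1) := by
      classical
      have h0 : Nat.find hP ≠ 0 := fun h0 => by
        have := Nat.find_spec hP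
        rw [h0] at this
        refine hy ?_
        rw [← one_smul (admissibleAlgebra K Γ.tilde)ᵐᵒᵖ y, hB]
        exact this 1 ⟨_, rfl⟩
      obtain ⟨k, hk⟩ := Nat.exists_eq_succ_of_ne_zero h0
      exact ⟨k, Nat.find_min hP (hk ▸ Nat.lt_succ_self k),
        by simpa only [hk] using Nat.find_spec hP⟩
    obtain ⟨r, ⟨z, hz⟩, hr⟩ : ∃ r : (admissibleAlgebra K Γ.tilde)ᵐᵒᵖ,
      r • m ∈ (shift K Γ ^ k).range ∧ r • m ∉ B := by simpa [P] using hk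
    -- The annihilator of the coefficients of `r • m` in level `k` annihilates `r • y`.
    let g : ((inclusion K Γ).obj (grothendieckModule K Γ)).obj := moduleProjection K Γ z
    have hg (s : (admissibleAlgebra K Γ.tilde)ᵐᵒᵖ) (hs : s • g = 0) : s • r • y = 0 := by
      obtain ⟨z', hz'⟩ := moduleProjection_eq_zero_iff.1
        (((moduleProjection K Γ).hom.map_smul s z).trans hs)
      rw [← mul_smul, hB]
      refine hk' _ ⟨z', ?_⟩
      rw [mul_smul, ← hz, pow_succ, Module.End.mul_apply, hz']
      exact (shift K Γ ^ k).map_smul s z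
    obtain ⟨f, _, -⟩ := exists_epi_hullSubmodule
      (X := (inclusion K Γ).obj (grothendieckModule K Γ)) (Y := X) hg
    obtain ⟨Y₁, -, e₁, -, -⟩ := exists_mono (F := inclusion K Γ)
      (hullSubtype (X := (inclusion K Γ).obj (grothendieckModule K Γ)) (Submodule.span _ {g}))
    obtain ⟨Y₂, -, e₂, -, -⟩ := exists_epi (F := inclusion K Γ) (e₁.hom ≫ f)
    refine ⟨Y₂, e₂.inv ≫ hullSubtype _, fun h0 => ?_, inferInstance⟩
    refine hullSubmodule_not_isZero (X := X) (Submodule.mem_span_singleton_self (r • y)) ?_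
      ((isZero_iff.2 h0).of_iso e₂)
    rwa [Ne, hB]

theorem hasEnoughCompressibles_tilde (hΓ : Nonempty Γ.Vertex)
    (h : HasEnoughCompressibles (Grothendieck K Γ)) :
    HasEnoughCompressibles (Grothendieck K Γ.tilde) := by
  intro X hX
  have key {L : Grothendieck K Γ.tilde} (hL : IsCompressible L) (i : L ⟶ X) [Mono i] :
      ∃ L : Subobject X, IsCompressible (L : Grothendieck K Γ.tilde) :=
    ⟨Subobject.mk i, hL.of_iso (Subobject.underlyingIso i).symm⟩
  obtain ⟨k, _⟩ | ⟨Y, k, hY, _⟩ := exists_mono_grothendieckModule_or_inclusion hX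
  · exact key (isCompressible_grothendieckModule_tilde hΓ) k
  · obtain ⟨L, hL⟩ := h Y hY
    exact key (isCompressible_map (F := inclusion K Γ) hL) ((inclusion K Γ).map L.arrow ≫ k)

theorem isSubquotient_inclusion_grothendieckModule :
    IsSubquotient ((inclusion K Γ).obj (grothendieckModule K Γ))
      (grothendieckModule K Γ.tilde) := by
  have : Epi (ObjectProperty.homMk (moduleProjection K Γ) :
      grothendieckModule K Γ.tilde ⟶ (inclusion K Γ).obj (grothendieckModule K Γ)) :=
    (hull_epi_iff _).2 ((ModuleCat.epi_iff_surjective (moduleProjection K Γ)).1 inferInstance)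
  exact IsSubquotient.of_epi (ObjectProperty.homMk (moduleProjection K Γ) :
      grothendieckModule K Γ.tilde ⟶ (inclusion K Γ).obj (grothendieckModule K Γ))

/-- An object with `M_Γ̃` in its support has `M_Γ̃`, hence also `M_Γ`, as a subquotient; thus its
support contains all atoms of `G_Γ`. -/
theorem atom_grothendieckModule_le (hM : IsMonoform (grothendieckModule K Γ.tilde))
    {H : Grothendieck K Γ} (hH : IsMonoform H) :
    atom _ hM ≤ atom ((inclusion K Γ).obj H) (isMonoform_map hH) := by
  refine atom_le_atom_iff.2 fun X hX => ?_
  obtain ⟨L, i, _, hL, hs⟩ := (atom_mem_ASupp_iff hM).1 hX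
  obtain ⟨j, _⟩ := exists_mono_of_mono i hL
  have hX' := (isSubquotient_inclusion_grothendieckModule (K := K) (Γ := Γ)).trans
    ((IsSubquotient.of_mono j).trans hs)
  obtain ⟨N, k, hk, hN, hs'⟩ := (atom_mem_ASupp_iff _).1
    ((atom_map_mem_ASupp_iff (F := inclusion K Γ) hH).2 (atom_mem_ASupp_hullSelf hH))
  exact (atom_mem_ASupp_iff _).2 ⟨N, k, hk, hN, hs'.trans hX'⟩

/-- Objects of `G_Γ` are annihilated by `∑ c_{v,w}`, unlike the nonzero subobjects of `M_Γ̃`. -/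
theorem not_atomEquivalent_inclusion (hΓ : Nonempty Γ.Vertex) (H : Grothendieck K Γ) :
    ¬ AtomEquivalent (grothendieckModule K Γ.tilde) ((inclusion K Γ).obj H) := by
  rw [atomEquivalent_iff]
  rintro ⟨X, i, j, _, _, hX⟩
  obtain ⟨v⟩ := hΓ
  obtain ⟨_, ⟨x, rfl⟩, hx⟩ := exists_liftScalar_pow_smul_ne_zero v (range_ne_bot i hX)
  refine hx 1 ?_
  let j' : X.obj ⟶ (modInclusion K Γ).obj H.obj := j.hom
  have : Mono j' := (ModuleCat.mono_iff_injective _).2 ((hull_mono_iff j).1 inferInstance)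
  rw [pow_one]
  refine (i.hom.hom.map_smul _ x).symm.trans ((congrArg i.hom.hom ?_).trans (map_zero i.hom.hom))
  exact smul_eq_zero_of_mono j' (projection_op_stepScalar v _) x

end ColoredQuiver

theorem mainTheorem2 (K : Type u) [Field K] (Γ : ColoredQuiver.{u}) (hΓ : Nonempty Γ.Vertex)
    (h_noeth : IsNoetherianObject (ColoredQuiver.grothendieckModule K Γ))
    (h_compr : HasEnoughCompressibles (ColoredQuiver.Grothendieck K Γ)) :
    IsCompressible (ColoredQuiver.grothendieckModule K Γ.tilde) ∧
    IsNoetherianObject (ColoredQuiver.grothendieckModule K Γ.tilde) ∧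
    IsLocallyNoetherianGrothendieck.{u} (ColoredQuiver.Grothendieck K Γ.tilde) ∧
    HasEnoughCompressibles (ColoredQuiver.Grothendieck K Γ.tilde) ∧
    ∃ (hM : IsMonoform (ColoredQuiver.grothendieckModule K Γ.tilde))
      (φ : ASpec (ColoredQuiver.Grothendieck K Γ) ↪o
        ASpec (ColoredQuiver.Grothendieck K Γ.tilde)),
      (∀ (H : ColoredQuiver.Grothendieck K Γ) (hH : IsMonoform H),
        ∃ hH' : IsMonoform ((ColoredQuiver.inclusion K Γ).obj H),
          φ (atom H hH) = atom ((ColoredQuiver.inclusion K Γ).obj H) hH') ∧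
      Set.univ = Set.range φ ∪ {atom (ColoredQuiver.grothendieckModule K Γ.tilde) hM} ∧
      ∀ α, atom (ColoredQuiver.grothendieckModule K Γ.tilde) hM < φ α := by
  have hM := ColoredQuiver.isMonoform_grothendieckModule_tilde (K := K) hΓ
  refine ⟨ColoredQuiver.isCompressible_grothendieckModule_tilde hΓ,
    (ColoredQuiver.isNoetherianObject_grothendieckModule_tilde h_noeth).1,
    (ColoredQuiver.isNoetherianObject_grothendieckModule_tilde h_noeth).2,
    ColoredQuiver.hasEnoughCompressibles_tilde hΓ h_compr, hM,
    IsSubquotientClosedEmbedding.aspecEmbedding (ColoredQuiver.inclusion K Γ),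
    fun H hH => ⟨IsSubquotientClosedEmbedding.isMonoform_map hH,
      IsSubquotientClosedEmbedding.aspecEmbedding_atom _ H hH⟩, ?_, fun α => ?_⟩
  · refine (Set.eq_univ_of_forall fun α => ?_).symm
    obtain ⟨X, hX, rfl⟩ := atom_surjective α
    obtain ⟨k, _⟩ | ⟨Y, k, hY, _⟩ :=
      ColoredQuiver.exists_mono_grothendieckModule_or_inclusion hX.1
    · exact Or.inr (atom_eq_iff.2 (AtomEquivalent.of_mono k hM.1).symm)
    · have hFY := hX.of_mono k fun h0 => hY (IsSubquotientClosedEmbedding.isZero_iff.1 h0)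
      exact Or.inl ⟨atom Y (IsSubquotientClosedEmbedding.isMonoform_of_map hFY),
        atom_eq_iff.2 (AtomEquivalent.of_mono k hFY.1)⟩
  · obtain ⟨H, hH, rfl⟩ := atom_surjective α
    exact lt_of_le_of_ne (ColoredQuiver.atom_grothendieckModule_le hM hH)
      fun h => ColoredQuiver.not_atomEquivalent_inclusion hΓ H (atom_eq_iff.1 h)
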